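/- **Setting.** All alphabets $\mathcal S,\mathcal U,\hat{\mathcal S},\hat{\mathcal U},\mathcal X,\mathcal Y,\mathcal Z$ are finite, $\mathcal X\neq\emptyset$, logarithms are to base 2. $(S_i,U_i)$, $i\ge 1$, are i.i.d. with law $p_{S,U}$; $d_s:\mathcal S\times\hat{\mathcal S}\to[0,\infty)$ and $d_u:\mathcal U\times\hat{\mathcal U}\to[0,\infty)$ are distortion measures, extended to blocks of length $k$ by averaging over the letters. The memoryless wiretap channel is degraded: $p_{Y,Z|X}=p_{Y|X}p_{Z|Y}$. A $(k,n)$-code consists of a finite key alphabet $\mathcal K$ with a law $p_K$ (the key $K$ is independent of the source), a stochastic encoder producing $X^n$ from $(U^k,K)$ (Case 1) or from $(S^k,U^k,K)$ (Case 2), and decoders $\hat S^k=\hat f_s(Y^n,K)$, $\hat U^k=\hat f_u(Y^n,K)$. A tuple $(r,R_k,D_s,D_u,\Delta_s,\Delta_u,\Delta_{su})\in\mathbb R_+^7$ is achievable (in the given case) if for every $\epsilon>0$ there is a $(k,n)$-code with $n/k\le r+\epsilon$, $\frac1k\log|\mathcal K|\le R_k+\epsilon$, $\mathbb E\,d_s(S^k,\hat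 S^k)\le D_s+\epsilon$, $\mathbb E\,d_u(U^k,\hat U^k)\le D_u+\epsilon$, $\frac1kH(S^k|Z^n)\ge\Delta_s-\epsilon$, $\frac1kH(U^k|Z^n)\ge\Delta_u-\epsilon$, $\frac1kH(S^k,U^k|Z^n)\ge\Delta_{su}-\epsilon$. Rate-distortion functions ($\inf\emptyset=+\infty$): $R(D_s)=\inf I(S;\hat S)$ over $p_{\hat S|S}$ with $\mathbb E\,d_s(S,\hat S)\le D_s$, and $R(D_u)=\inf I(U;\hat U)$ over $p_{\hat U|U}$ with $\mathbb E\,d_u(U,\hat U)\le D_u$. In Case 1, $R(D_s,D_u)=\inf I(U;\hat S,\hat U)$ over $p_{\hat S,\hat U|U}$ with $\mathbb E\,\hat d_s(U,\hat S)\le D_s$ and $\mathbb E\,d_u(U,\hat U)\le D_u$, where $\hat d_s(u,\hat s)=\sum_s p_{S|U}(s|u)\,d_s(s,\hat s)$. In Case 2, $R(D_s,D_u)=\inf I(S,U;\hat S,\hat U)$ over $p_{\hat S,\hat U|S,U}$ with $\mathbb E\,d_s(S,\hat S)\le D_s$ and $\mathbb E\,d_u(U,\hat U)\le D_u$. **Theorem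 (Converse).** In Case 1 and in Case 2, for every achievable tuple $(r,R_k,D_s,D_u,\Delta_s,\Delta_u,\Delta_{su})$ there is an input law $p_X$ on $\mathcal X$ such that $$\begin{aligned} R(D_s,D_u)&\le r\,I(X;Y),\\ \Delta_s&\le R_k+r\max I(W_s;Y|Z)-R(D_s)+H(S),\\ \Delta_u&\le R_k+r\max I(W_u;Y|Z)-R(D_u)+H(U),\\ \Delta_{su}&\le R_k+r\max I(W_s,W_u;Y|Z)-R(D_s,D_u)+H(S,U). \end{aligned}$$ Each maximum is attained and is taken over all auxiliary pairs $W=(W_s,W_u)$ taking values in a set $\mathcal W$ with $|\mathcal W|\le|\mathcal X|+1$, jointly distributed with $X\sim p_X$ and the channel outputs $Y,Z$ so that $p_{W_s,W_u,X,Y,Z}=p_{W_s}\,p_{W_u|W_s}\,p_{X|W_u}\,p_{Y|X}\,p_{Z|Y}$ in Case 1 and $p_{W_s,W_u,X,Y,Z}=p_{W_s,W_u}\,p_{X|W_s,W_u}\,p_{Y|X}\,p_{Z|Y}$ in Case 2. -/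

import Mathlib

namespace SemanticWiretap

noncomputable section

/-! ### Finite probability: laws, random variables, entropy and information (in bits)

A law on a finite type `Ω` is an element of `stdSimplex ℝ Ω`; a random variable on it is a
function on `Ω`. -/

/-- A stochastic matrix (transition law) from `A` to `B`. -/
def IsStochastic {A B : Type*} [Fintype B] (q : A → B → ℝ) : Prop :=
  ∀ a, q a ∈ stdSimplex ℝ B

open Classical in
/-- The probability mass function of the random variable `f` under the law `P`. -/
def pmfOf {Ω A : Type*} [Fintype Ω] (P : Ω → ℝ) (f : Ω → A) (a : A) : ℝ :=
  ∑ ω, if f ω = a then P ω else 0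

/-- Shannon entropy `H(f)` in bits. -/
def entropy {Ω A : Type*} [Fintype Ω] [Fintype A] (P : Ω → ℝ) (f : Ω → A) : ℝ :=
  -∑ a, pmfOf P f a * Real.logb 2 (pmfOf P f a)

/-- Conditional entropy `H(f | g) = H(f, g) - H(g)`. -/
def condEntropy {Ω A B : Type*} [Fintype Ω] [Fintype A] [Fintype B]
    (P : Ω → ℝ) (f : Ω → A) (g : Ω → B) : ℝ :=
  entropy P (fun ω => (f ω, g ω)) - entropy P g

/-- Mutual information `I(f ; g) = H(f) - H(f | g)`. -/
def mutualInfo {Ω A B : Type*} [Fintype Ω] [Fintype A] [Fintype B]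
    (P : Ω → ℝ) (f : Ω → A) (g : Ω → B) : ℝ :=
  entropy P f - condEntropy P f g

/-- Conditional mutual information `I(f ; g | h) = H(f | h) - H(f | g, h)`. -/
def condMutualInfo {Ω A B C : Type*} [Fintype Ω] [Fintype A] [Fintype B] [Fintype C]
    (P : Ω → ℝ) (f : Ω → A) (g : Ω → B) (h : Ω → C) : ℝ :=
  condEntropy P f h - condEntropy P f (fun ω => (g ω, h ω))

/-- The joint law of an input with law `p` and the output of the transition law `q`. -/
def inputOutput {A B : Type*} (p : A → ℝ) (q : A → B → ℝ) : A × B → ℝ :=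
  fun ω => p ω.1 * q ω.1 ω.2

/-! ### Codes and achievability -/

/-- The two encoder configurations. -/
inductive EncoderCase
  /-- Case 1: the encoder sees `U^k` and the key. -/
  | observationOnly
  /-- Case 2: the encoder sees `S^k`, `U^k` and the key. -/
  | semanticAndObservation

/-- A `(k, n)` source-channel code: a finite key alphabet `{0, …, keySize - 1}` with a key law,
a stochastic encoder (a law on channel input words for each source word and key), and
deterministic decoders acting on the main channel output and the key. -/
structure Code (c : EncoderCase) (k n : ℕ) (S U Sh Uh X Y : Type*) [Fintype X] where
  keySize : ℕ
  keyLaw : Fin keySize → ℝ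
  keyLaw_mem : keyLaw ∈ stdSimplex ℝ (Fin keySize)
  enc : (Fin k → S) → (Fin k → U) → Fin keySize → (Fin n → X) → ℝ
  enc_mem : ∀ s u κ, enc s u κ ∈ stdSimplex ℝ (Fin n → X)
  enc_observationOnly : c = EncoderCase.observationOnly →
    ∀ s s' u κ, enc s u κ = enc s' u κ
  decS : (Fin n → Y) → Fin keySize → (Fin k → Sh)
  decU : (Fin n → Y) → Fin keySize → (Fin k → Uh)

section Code

variable {c : EncoderCase} {k n : ℕ} {S U Sh Uh X Y Z : Type*} [Fintype X]

/-- The sample space of one use of a code: `(S^k, U^k, K, X^n, Y^n, Z^n)`. -/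
abbrev Outcome (k n m : ℕ) (S U X Y Z : Type*) : Type _ :=
  (Fin k → S) × (Fin k → U) × Fin m × (Fin n → X) × (Fin n → Y) × (Fin n → Z)

/-- The law of `(S^k, U^k, K, X^n, Y^n, Z^n)` induced by a code, for the memoryless source `p`
and the memoryless wiretap channel `Q = p_{Y,Z|X}`; the key is independent of the source. -/
def Code.law (C : Code c k n S U Sh Uh X Y) (p : S × U → ℝ) (Q : X → Y × Z → ℝ) :
    Outcome k n C.keySize S U X Y Z → ℝ :=
  fun ⟨s, u, κ, x, y, z⟩ =>
    (∏ i, p (s i, u i)) * C.keyLaw κ * C.enc s u κ x * ∏ j, Q (x j) (y j, z j)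

/-- `E d_s(S^k, Ŝ^k)`. -/
def Code.distS [Fintype S] [Fintype U] [Fintype Y] [Fintype Z]
    (C : Code c k n S U Sh Uh X Y) (p : S × U → ℝ) (Q : X → Y × Z → ℝ)
    (dS : S → Sh → ℝ) : ℝ :=
  ∑ ω : Outcome k n C.keySize S U X Y Z,
    C.law p Q ω * ((1 / (k : ℝ)) * ∑ i, dS (ω.1 i) (C.decS ω.2.2.2.2.1 ω.2.2.1 i))

/-- `E d_u(U^k, Û^k)`. -/
def Code.distU [Fintype S] [Fintype U] [Fintype Y] [Fintype Z]
    (C : Code c k n S U Sh Uh X Y) (p : S × U → ℝ) (Q : X → Y × Z → ℝ)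
    (dU : U → Uh → ℝ) : ℝ :=
  ∑ ω : Outcome k n C.keySize S U X Y Z,
    C.law p Q ω * ((1 / (k : ℝ)) * ∑ i, dU (ω.2.1 i) (C.decU ω.2.2.2.2.1 ω.2.2.1 i))

/-- `(1/k) H(S^k | Z^n)`. -/
def Code.equivS [Fintype S] [Fintype U] [Fintype Y] [Fintype Z]
    (C : Code c k n S U Sh Uh X Y) (p : S × U → ℝ) (Q : X → Y × Z → ℝ) : ℝ :=
  (1 / (k : ℝ)) * condEntropy (C.law p Q) (fun ω => ω.1) (fun ω => ω.2.2.2.2.2)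

/-- `(1/k) H(U^k | Z^n)`. -/
def Code.equivU [Fintype S] [Fintype U] [Fintype Y] [Fintype Z]
    (C : Code c k n S U Sh Uh X Y) (p : S × U → ℝ) (Q : X → Y × Z → ℝ) : ℝ :=
  (1 / (k : ℝ)) * condEntropy (C.law p Q) (fun ω => ω.2.1) (fun ω => ω.2.2.2.2.2)

/-- `(1/k) H(S^k, U^k | Z^n)`. -/
def Code.equivSU [Fintype S] [Fintype U] [Fintype Y] [Fintype Z]
    (C : Code c k n S U Sh Uh X Y) (p : S × U → ℝ) (Q : X → Y × Z → ℝ) : ℝ :=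
  (1 / (k : ℝ)) * condEntropy (C.law p Q) (fun ω => (ω.1, ω.2.1)) (fun ω => ω.2.2.2.2.2)

end Code

/-- The tuple `(r, R_k, D_s, D_u, Δ_s, Δ_u, Δ_su)` of nonnegative reals is achievable. -/
def Achievable {S U Sh Uh X Y Z : Type*} [Fintype S] [Fintype U] [Fintype X] [Fintype Y]
    [Fintype Z] (c : EncoderCase) (p : S × U → ℝ) (dS : S → Sh → ℝ) (dU : U → Uh → ℝ)
    (Q : X → Y × Z → ℝ) (r Rk Ds Du Δs Δu Δsu : ℝ) : Prop :=
  (0 ≤ r ∧ 0 ≤ Rk ∧ 0 ≤ Ds ∧ 0 ≤ Du ∧ 0 ≤ Δs ∧ 0 ≤ Δu ∧ 0 ≤ Δsu) ∧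
  ∀ ε : ℝ, 0 < ε → ∃ k n : ℕ, 0 < k ∧ ∃ C : Code c k n S U Sh Uh X Y,
    (n : ℝ) / k ≤ r + ε ∧
    (1 / (k : ℝ)) * Real.logb 2 C.keySize ≤ Rk + ε ∧
    C.distS p Q dS ≤ Ds + ε ∧
    C.distU p Q dU ≤ Du + ε ∧
    Δs - ε ≤ C.equivS p Q ∧
    Δu - ε ≤ C.equivU p Q ∧
    Δsu - ε ≤ C.equivSU p Q

/-! ### Rate-distortion functions

They take values in `EReal`, so that the infimum over an empty set of test channels is `⊤`. -/

/-- Classic rate-distortion function of a memoryless source `p`: infimum of `I(A ; Â)` over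
`p_{Â|A}` with `E d(A, Â) ≤ D`. -/
def classicRDF {A Ah : Type*} [Fintype A] [Fintype Ah] (p : A → ℝ) (d : A → Ah → ℝ)
    (D : ℝ) : EReal :=
  ⨅ (q : A → Ah → ℝ) (_ : IsStochastic q) (_ : ∑ a, ∑ b, p a * q a b * d a b ≤ D),
    ((mutualInfo (inputOutput p q) Prod.fst Prod.snd : ℝ) : EReal)

/-- The modified distortion `d̂_s(u, ŝ) = ∑ s, p_{S|U}(s|u) d_s(s, ŝ)`. -/
def modifiedDist {S U Sh : Type*} [Fintype S] [Fintype U] (p : S × U → ℝ) (dS : S → Sh → ℝ)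
    (u : U) (sh : Sh) : ℝ :=
  ∑ s, p (s, u) / pmfOf p Prod.snd u * dS s sh

/-- Semantic rate-distortion function with separate distortion constraints. In Case 1 it is the
infimum of `I(U ; Ŝ, Û)` over `p_{Ŝ,Û|U}` with `E d̂_s(U, Ŝ) ≤ D_s`, `E d_u(U, Û) ≤ D_u`;
in Case 2 it is the infimum of `I(S, U ; Ŝ, Û)` over `p_{Ŝ,Û|S,U}` with
`E d_s(S, Ŝ) ≤ D_s`, `E d_u(U, Û) ≤ D_u`. -/
def semanticRDF {S U Sh Uh : Type*} [Fintype S] [Fintype U] [Fintype Sh] [Fintype Uh]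
    (c : EncoderCase) (p : S × U → ℝ) (dS : S → Sh → ℝ) (dU : U → Uh → ℝ)
    (Ds Du : ℝ) : EReal :=
  match c with
  | .observationOnly =>
    ⨅ (q : U → Sh × Uh → ℝ) (_ : IsStochastic q)
      (_ : ∑ u, ∑ b, pmfOf p Prod.snd u * q u b * modifiedDist p dS u b.1 ≤ Ds)
      (_ : ∑ u, ∑ b, pmfOf p Prod.snd u * q u b * dU u b.2 ≤ Du),
      ((mutualInfo (inputOutput (pmfOf p Prod.snd) q) Prod.fst Prod.snd : ℝ) : EReal)
  | .semanticAndObservation =>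
    ⨅ (q : S × U → Sh × Uh → ℝ) (_ : IsStochastic q)
      (_ : ∑ a, ∑ b, p a * q a b * dS a.1 b.1 ≤ Ds)
      (_ : ∑ a, ∑ b, p a * q a b * dU a.2 b.2 ≤ Du),
      ((mutualInfo (inputOutput p q) Prod.fst Prod.snd : ℝ) : EReal)

/-! ### Auxiliary random variables -/

/-- Labels for the values of each auxiliary variable; `|𝒳| + 1` labels are enough because the
pair `(W_s, W_u)` has at most `|𝒳| + 1` values. -/
abbrev Label (X : Type*) [Fintype X] : Type := Fin (Fintype.card X + 1)

/-- `w` is an admissible law of `(W_s, W_u, X)`: it has `X`-marginal `pX`; the pair `(W_s, W_u)`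
takes values in a set of at most `|𝒳| + 1` elements; and `w` factors as
`p_{W_s} p_{W_u|W_s} p_{X|W_u}` in Case 1 and as `p_{W_s,W_u} p_{X|W_s,W_u}` in Case 2. -/
def IsAuxLaw {X : Type*} [Fintype X] (c : EncoderCase) (pX : X → ℝ)
    (w : Label X × Label X × X → ℝ) : Prop :=
  pmfOf w (fun ω => ω.2.2) = pX ∧
  (∃ 𝒲 : Finset (Label X × Label X), 𝒲.card ≤ Fintype.card X + 1 ∧
    ∀ a b x, (a, b) ∉ 𝒲 → w (a, b, x) = 0) ∧
  match c with
  | .observationOnly =>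
    ∃ (pA : Label X → ℝ) (qB : Label X → Label X → ℝ) (qX : Label X → X → ℝ),
      pA ∈ stdSimplex ℝ (Label X) ∧ IsStochastic qB ∧ IsStochastic qX ∧
      ∀ a b x, w (a, b, x) = pA a * qB a b * qX b x
  | .semanticAndObservation =>
    ∃ (pAB : Label X × Label X → ℝ) (qX : Label X × Label X → X → ℝ),
      pAB ∈ stdSimplex ℝ (Label X × Label X) ∧ IsStochastic qX ∧
      ∀ a b x, w (a, b, x) = pAB (a, b) * qX (a, b) x

/-- The law of `((W_s, W_u), X, Y, Z)` obtained by sending `X` over the wiretap channel `Q`. -/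
def auxLaw {X Y Z : Type*} [Fintype X] (w : Label X × Label X × X → ℝ)
    (Q : X → Y × Z → ℝ) : (Label X × Label X) × X × Y × Z → ℝ :=
  fun ⟨⟨a, b⟩, x, y, z⟩ => w (a, b, x) * Q x (y, z)

/-- The values `I(g(W_s, W_u) ; Y | Z)` over all admissible auxiliary laws. -/
def secrecyValues {X Y Z T : Type*} [Fintype X] [Fintype Y] [Fintype Z] [Fintype T]
    (c : EncoderCase) (pX : X → ℝ) (Q : X → Y × Z → ℝ) (g : Label X × Label X → T) : Set ℝ :=
  {v | ∃ w, IsAuxLaw c pX w ∧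
    v = condMutualInfo (auxLaw w Q) (fun ω => g ω.1) (fun ω => ω.2.2.1) (fun ω => ω.2.2.2)}

end

end SemanticWiretap

open SemanticWiretap

/-! Each code is summarised by two averaged single-letter laws: `pX`, the average law of the channel
input letters, and `π`, the average law of source letters with their reconstructions. Everything is
bounded in terms of this pair.

For a function F of the source block, H(F|Z^n) ≤ H(F|Y^n,K,Z^n) + log|K| + I(F;Y^n|Z^n)
(`condEntropy_le_add_key`). The first term is at most the uncertainty left by the reconstructions,
which single-letterises to a conditional entropy under `π`. The last is at most I(X^n;Y^n|Z^n) ≤ n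
I(X;Y|Z) under `pX`. For the rate constraint, independence of key and source gives I(F;Y^n,K) ≤
I(X^n;Y^n) ≤ n I(X;Y) (`mutualInfo_key_le`). The single-letter steps rest on Gibbs' inequality
(`condEntropy_le_cross`): the block is compared with a product of conditional laws of the averaged
letter, which takes the place of a time-sharing variable.

The pair (`pX`, `π`) lives in a product of simplices and all constraints are closed in it and in the
slack ε. Compactness therefore yields one pair satisfying them all at ε = 0
(`Achievable.exists_singleLetter_zero`). This limit `π` is itself a feasible test channel, so the
rate-distortion functions are bounded without any appeal to their convexity or continuity.

Finally, each of the three maxima equals I(X;Y|Z): data processing gives the upper bound, and W_s =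
W_u = X, admissible in both cases, attains it (`isGreatest_secrecyValues`). -/

namespace SemanticWiretap

/-! ### Laws of random variables -/

section Laws

variable {Ω A B : Type*} [Fintype Ω] (P : Ω → ℝ)

lemma pmfOf_eq [DecidableEq A] (f : Ω → A) (a : A) :
    pmfOf P f a = ∑ ω, if f ω = a then P ω else 0 := by
  unfold pmfOf
  congr! 2

variable {P}

lemma pmfOf_nonneg (hP : ∀ ω, 0 ≤ P ω) (f : Ω → A) (a : A) : 0 ≤ pmfOf P f a := by
  classical
  rw [pmfOf_eq]
  exact Finset.sum_nonneg fun ω _ => by split_ifs <;> simp [hP]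

lemma le_pmfOf_self (hP : ∀ ω, 0 ≤ P ω) (f : Ω → A) (ω : Ω) : P ω ≤ pmfOf P f (f ω) := by
  classical
  rw [pmfOf_eq]
  have := Finset.single_le_sum (s := Finset.univ)
    (f := fun ω' => if f ω' = f ω then P ω' else 0)
    (fun ω' _ => by split_ifs <;> simp [hP]) (Finset.mem_univ ω)
  simpa using this

lemma pmfOf_self_pos (hP : ∀ ω, 0 ≤ P ω) (f : Ω → A) {ω : Ω} (h : P ω ≠ 0) :
    0 < pmfOf P f (f ω) :=
  ((hP ω).lt_of_ne' h).trans_le (le_pmfOf_self hP f ω)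

variable (P)

/-- Expectation of a function of a random variable. -/
lemma sum_pmfOf_mul [Fintype A] (f : Ω → A) (φ : A → ℝ) :
    ∑ a, pmfOf P f a * φ a = ∑ ω, P ω * φ (f ω) := by
  classical
  simp only [pmfOf_eq, Finset.sum_mul]
  rw [Finset.sum_comm]
  refine Finset.sum_congr rfl fun ω _ => ?_
  simp [ite_mul]

lemma sum_pmfOf [Fintype A] (f : Ω → A) : ∑ a, pmfOf P f a = ∑ ω, P ω := by
  simpa using sum_pmfOf_mul P f (fun _ => 1)

lemma pmfOf_pmfOf [Fintype A] (f : Ω → A) (φ : A → B) (b : B) :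
    pmfOf (pmfOf P f) φ b = pmfOf P (fun ω => φ (f ω)) b := by
  classical
  rw [pmfOf_eq, pmfOf_eq]
  have := sum_pmfOf_mul P f (fun a => if φ a = b then 1 else 0)
  simpa [mul_ite] using this

lemma pmfOf_mem_stdSimplex [Fintype A] (hP : P ∈ stdSimplex ℝ Ω) (f : Ω → A) :
    pmfOf P f ∈ stdSimplex ℝ A :=
  ⟨fun a => pmfOf_nonneg hP.1 f a, by rw [sum_pmfOf, hP.2]⟩

lemma sum_pmfOf_pair [Fintype A] (f : Ω → A) (g : Ω → B) (b : B) :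
    ∑ a, pmfOf P (fun ω => (f ω, g ω)) (a, b) = pmfOf P g b := by
  classical
  simp only [pmfOf_eq]
  rw [Finset.sum_comm]
  refine Finset.sum_congr rfl fun ω _ => ?_
  simp [Prod.ext_iff, ite_and]

lemma pmfOf_of_injective {f : Ω → A} (hf : Function.Injective f) (ω : Ω) :
    pmfOf P f (f ω) = P ω := by
  classical
  rw [pmfOf_eq]
  simp [hf.eq_iff]

/-- The conditional law of `f` given `g`. -/
noncomputable def condLaw (P : Ω → ℝ) (f : Ω → A) (g : Ω → B) (b : B) (a : A) : ℝ :=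
  pmfOf P (fun ω => (f ω, g ω)) (a, b) / pmfOf P g b

lemma condLaw_nonneg {P : Ω → ℝ} (hP : ∀ ω, 0 ≤ P ω) (f : Ω → A) (g : Ω → B) (b : B) (a : A) :
    0 ≤ condLaw P f g b a :=
  div_nonneg (pmfOf_nonneg hP _ _) (pmfOf_nonneg hP _ _)

/-- Where `b` has mass zero, division by zero makes the whole row vanish, so the rows are only
substochastic. Gibbs' inequality below asks for no more. -/
lemma sum_condLaw_le_one [Fintype A] (P : Ω → ℝ) (f : Ω → A) (g : Ω → B) (b : B) :
    ∑ a, condLaw P f g b a ≤ 1 := by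
  unfold condLaw
  rw [← Finset.sum_div, sum_pmfOf_pair]
  exact div_self_le_one _

lemma condLaw_self_pos {P : Ω → ℝ} (hP : ∀ ω, 0 ≤ P ω) (f : Ω → A) (g : Ω → B) {ω : Ω} (h : P ω ≠ 0) :
    0 < condLaw P f g (g ω) (f ω) :=
  div_pos (pmfOf_self_pos hP (fun ω => (f ω, g ω)) h) (pmfOf_self_pos hP g h)

end Laws

/-! ### Entropy -/

section Entropy

variable {Ω A B C D : Type*} [Fintype Ω] [Fintype A] [Fintype B] [Fintype C] [Fintype D]
variable {P : Ω → ℝ}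

lemma entropy_eq_sum (P : Ω → ℝ) (f : Ω → A) :
    entropy P f = ∑ ω, P ω * -Real.logb 2 (pmfOf P f (f ω)) := by
  unfold entropy
  rw [sum_pmfOf_mul P f (fun a => Real.logb 2 (pmfOf P f a)), ← Finset.sum_neg_distrib]
  simp

lemma entropy_congr_law {Ω' : Type*} [Fintype Ω'] {P : Ω → ℝ} {P' : Ω' → ℝ} {f : Ω → A}
    {f' : Ω' → A} (h : ∀ a, pmfOf P f a = pmfOf P' f' a) : entropy P f = entropy P' f' := by
  unfold entropy
  simp only [h]

lemma entropy_pmfOf (P : Ω → ℝ) (f : Ω → A) (φ : A → B) :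
    entropy (pmfOf P f) φ = entropy P (fun ω => φ (f ω)) :=
  entropy_congr_law fun b => pmfOf_pmfOf P f φ b

/-- Entropy depends only on the partition of the support induced by the variable. -/
lemma entropy_congr_support (P : Ω → ℝ) (f : Ω → A) (f' : Ω → B)
    (h : ∀ ω ω', P ω ≠ 0 → P ω' ≠ 0 → (f ω = f ω' ↔ f' ω = f' ω')) :
    entropy P f = entropy P f' := by
  classical
  rw [entropy_eq_sum, entropy_eq_sum]
  refine Finset.sum_congr rfl fun ω _ => ?_
  by_cases hω : P ω = 0
  · simp [hω]
  congr 3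
  rw [pmfOf_eq, pmfOf_eq]
  refine Finset.sum_congr rfl fun ω' _ => ?_
  by_cases hω' : P ω' = 0
  · simp [hω']
  simp only [h ω' ω hω' hω]

lemma entropy_congr_iff (P : Ω → ℝ) (f : Ω → A) (f' : Ω → B)
    (h : ∀ ω ω', f ω = f ω' ↔ f' ω = f' ω') : entropy P f = entropy P f' :=
  entropy_congr_support P f f' fun ω ω' _ _ => h ω ω'

lemma condEntropy_eq_sum (hP : ∀ ω, 0 ≤ P ω) (f : Ω → A) (g : Ω → B) :
    condEntropy P f g = ∑ ω, P ω *
      -Real.logb 2 (pmfOf P (fun ω => (f ω, g ω)) (f ω, g ω) / pmfOf P g (g ω)) := by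
  unfold condEntropy
  rw [entropy_eq_sum, entropy_eq_sum, ← Finset.sum_sub_distrib]
  refine Finset.sum_congr rfl fun ω _ => ?_
  by_cases hω : P ω = 0
  · simp [hω]
  rw [Real.logb_div (pmfOf_self_pos hP (fun ω => (f ω, g ω)) hω).ne'
    (pmfOf_self_pos hP g hω).ne']
  ring

/-- Gibbs' inequality in conditional form. -/
lemma condEntropy_le_cross (hP : ∀ ω, 0 ≤ P ω) (f : Ω → A) (g : Ω → B) (q : B → A → ℝ)
    (hq : ∀ b a, 0 ≤ q b a) (hq1 : ∀ b, ∑ a, q b a ≤ 1)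
    (hpos : ∀ ω, P ω ≠ 0 → 0 < q (g ω) (f ω)) :
    condEntropy P f g ≤ ∑ ω, P ω * -Real.logb 2 (q (g ω) (f ω)) := by
  rw [condEntropy_eq_sum hP]
  set j := pmfOf P (fun ω => (f ω, g ω)) with hj
  set m := pmfOf P g with hm
  have hlog : 0 < Real.log 2 := Real.log_pos (by norm_num)
  -- Pointwise log t ≤ t - 1 at t = q·m/j. After summation the right-hand side is nonpositive,
  -- because q·m has total mass at most that of `P`.
  have key : ∀ ω, P ω * -Real.logb 2 (j (f ω, g ω) / m (g ω)) -
      P ω * -Real.logb 2 (q (g ω) (f ω)) ≤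
      (P ω * (q (g ω) (f ω) * m (g ω) / j (f ω, g ω)) - P ω) / Real.log 2 := by
    intro ω
    by_cases hω : P ω = 0
    · simp [hω]
    have h1 : 0 < j (f ω, g ω) := pmfOf_self_pos hP (fun ω => (f ω, g ω)) hω
    have h2 : 0 < m (g ω) := pmfOf_self_pos hP g hω
    have h3 := hpos ω hω
    have e : P ω * -Real.logb 2 (j (f ω, g ω) / m (g ω)) - P ω * -Real.logb 2 (q (g ω) (f ω))
        = P ω * Real.log (q (g ω) (f ω) * m (g ω) / j (f ω, g ω)) / Real.log 2 := by
      rw [Real.log_div (by positivity) h1.ne', Real.log_mul h3.ne' h2.ne',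
        Real.logb, Real.logb, Real.log_div h1.ne' h2.ne']
      ring
    rw [e]
    gcongr
    have := Real.log_le_sub_one_of_pos (show 0 < q (g ω) (f ω) * m (g ω) / j (f ω, g ω) by
      positivity)
    nlinarith [hP ω]
  have hsum : ∑ ω, P ω * (q (g ω) (f ω) * m (g ω) / j (f ω, g ω)) ≤ ∑ ω, P ω := by
    rw [← sum_pmfOf_mul P (fun ω => (f ω, g ω)) (fun ab => q ab.2 ab.1 * m ab.2 / j ab),
      ← sum_pmfOf P g, Fintype.sum_prod_type_right]
    refine Finset.sum_le_sum fun b _ => ?_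
    calc ∑ a, j (a, b) * (q b a * m b / j (a, b)) ≤ ∑ a, q b a * m b := by
          refine Finset.sum_le_sum fun a _ => ?_
          have hm0 : 0 ≤ m b := pmfOf_nonneg hP g b
          by_cases h0 : j (a, b) = 0
          · simp only [h0, zero_mul]; exact mul_nonneg (hq b a) hm0
          · rw [mul_div_cancel₀ _ h0]
      _ = (∑ a, q b a) * m b := by rw [Finset.sum_mul]
      _ ≤ m b := mul_le_of_le_one_left (pmfOf_nonneg hP g b) (hq1 b)
  have := Finset.sum_le_sum fun ω (_ : ω ∈ Finset.univ) => key ω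
  rw [Finset.sum_sub_distrib, ← Finset.sum_div, Finset.sum_sub_distrib] at this
  have h0 : (∑ ω, P ω * (q (g ω) (f ω) * m (g ω) / j (f ω, g ω)) - ∑ ω, P ω) / Real.log 2 ≤ 0 :=
    div_nonpos_of_nonpos_of_nonneg (by linarith) hlog.le
  linarith

/-- Conditioning on more reduces entropy. -/
lemma condEntropy_le_of_comp (hP : ∀ ω, 0 ≤ P ω) (f : Ω → A) (G : Ω → B) (φ : B → C) :
    condEntropy P f G ≤ condEntropy P f (fun ω => φ (G ω)) := by
  rw [condEntropy_eq_sum hP f (fun ω => φ (G ω))]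
  exact condEntropy_le_cross hP f G (fun b => condLaw P f (fun ω => φ (G ω)) (φ b))
    (fun b a => condLaw_nonneg hP _ _ _ _) (fun b => sum_condLaw_le_one _ _ _ _)
    fun ω h => condLaw_self_pos hP f (fun ω => φ (G ω)) h

lemma condEntropy_nonneg (hP : ∀ ω, 0 ≤ P ω) (f : Ω → A) (g : Ω → B) :
    0 ≤ condEntropy P f g := by
  rw [condEntropy_eq_sum hP]
  refine Finset.sum_nonneg fun ω _ => mul_nonneg (hP ω) (neg_nonneg.2 ?_)
  refine Real.logb_nonpos (by norm_num) (condLaw_nonneg hP f g _ _) ?_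
  exact (Finset.single_le_sum (f := condLaw P f g (g ω))
    (fun a _ => condLaw_nonneg hP _ _ _ a) (Finset.mem_univ (f ω))).trans
    (sum_condLaw_le_one P f g _)

/-- Gibbs' inequality against the uniform law on `A`. It prices the key by the logarithm of its
alphabet size. -/
lemma condEntropy_le_logb_card (hP : P ∈ stdSimplex ℝ Ω) (f : Ω → A) (g : Ω → B) :
    condEntropy P f g ≤ Real.logb 2 (Fintype.card A) := by
  have hA : ∀ ω, P ω ≠ 0 → (0 : ℝ) < 1 / Fintype.card A := fun ω _ => by
    have : Nonempty A := ⟨f ω⟩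
    have : 0 < Fintype.card A := Fintype.card_pos
    positivity
  refine (condEntropy_le_cross hP.1 f g (fun _ _ => 1 / Fintype.card A) (fun _ _ => by positivity)
    (fun _ => ?_) hA).trans_eq ?_
  · rw [Finset.sum_const, Finset.card_univ, nsmul_eq_mul, mul_one_div]
    exact div_self_le_one _
  · rw [← Finset.sum_mul, hP.2, one_div, Real.logb_inv]
    ring

/-- Subadditivity of conditional entropy in the form `H(f | g) ≤ H(f)`. -/
lemma condEntropy_le_entropy (hP : P ∈ stdSimplex ℝ Ω) (f : Ω → A) (g : Ω → B) :
    condEntropy P f g ≤ entropy P f := by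
  have h := condEntropy_le_of_comp hP.1 f g (fun _ => ())
  have e1 : entropy P (fun _ => ()) = 0 := by
    rw [entropy_eq_sum]
    have : pmfOf P (fun _ => ()) () = 1 := by rw [pmfOf_eq]; simpa using hP.2
    simp [this]
  have e2 : entropy P (fun ω => (f ω, ())) = entropy P f :=
    entropy_congr_iff _ _ _ fun ω ω' => by simp
  unfold condEntropy at h ⊢
  rw [e1, e2] at h
  linarith

end Entropy

/-! ### Conditional laws given by a kernel -/

section Kernel

variable {Ω A B C D : Type*} [Fintype Ω]

/-- `W` is a version of the conditional law of `f` given `g`. -/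
def HasKernel (P : Ω → ℝ) (f : Ω → A) (g : Ω → B) (W : B → A → ℝ) : Prop :=
  ∀ a b, pmfOf P (fun ω => (f ω, g ω)) (a, b) = pmfOf P g b * W b a

/-- When a sample point is the same datum as the pair (f, g), a factorised formula for `P` can be
read off as marginal times kernel. The concrete laws of codes, channels and auxiliary variables are
disintegrated this way. -/
lemma hasKernel_of_bijective [Fintype A] [Fintype B] {P : Ω → ℝ} {f : Ω → A} {g : Ω → B}
    {W : B → A → ℝ} {μ : B → ℝ} (hbij : Function.Bijective fun ω => (f ω, g ω))
    (hP : ∀ ω, P ω = μ (g ω) * W (g ω) (f ω)) (hW : ∀ b, ∑ a, W b a = 1) :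
    (∀ b, pmfOf P g b = μ b) ∧ HasKernel P f g W := by
  have h1 : ∀ a b, pmfOf P (fun ω => (f ω, g ω)) (a, b) = μ b * W b a := by
    intro a b
    obtain ⟨ω, hω⟩ := hbij.2 (a, b)
    rw [← hω, pmfOf_of_injective P hbij.1, hP]
    simp only [Prod.mk.injEq] at hω
    rw [hω.1, hω.2]
  have h2 : ∀ b, pmfOf P g b = μ b := by
    intro b
    rw [← sum_pmfOf_pair P f g b]
    simp only [h1]
    rw [← Finset.mul_sum, hW, mul_one]
  exact ⟨h2, fun a b => by rw [h1, h2]⟩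

/-- The kernel is constant on the fibres of `φ`, so summing over a fibre leaves it unchanged. This
is the form in which Markov chains are used. -/
lemma HasKernel.comp_right [Fintype A] [Fintype B] {P : Ω → ℝ} {f : Ω → A} {g : Ω → B}
    {φ : B → C} {W : C → A → ℝ} (h : HasKernel P f g fun b => W (φ b)) :
    HasKernel P f (fun ω => φ (g ω)) W := by
  classical
  intro a c
  rw [← pmfOf_pmfOf P (fun ω => (f ω, g ω)) (fun ab => (ab.1, φ ab.2)) (a, c),
    ← pmfOf_pmfOf P g φ c, pmfOf_eq, pmfOf_eq, Fintype.sum_prod_type_right, Finset.sum_mul]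
  refine Finset.sum_congr rfl fun b _ => ?_
  by_cases hb : φ b = c
  · simp [hb, h a b]
  · simp [hb]

lemma HasKernel.comp_left [Fintype A] [Fintype B] {P : Ω → ℝ} {f : Ω → A} {g : Ω → B}
    {W : B → A → ℝ} (h : HasKernel P f g W) (ψ : A → C) :
    HasKernel P (fun ω => ψ (f ω)) g fun b => pmfOf (W b) ψ := by
  classical
  intro c b
  rw [← pmfOf_pmfOf P (fun ω => (f ω, g ω)) (fun ab => (ψ ab.1, ab.2)) (c, b),
    pmfOf_eq, Fintype.sum_prod_type]
  change _ = pmfOf P g b * pmfOf (W b) ψ c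
  rw [pmfOf_eq (W b), Finset.mul_sum]
  refine Finset.sum_congr rfl fun a _ => ?_
  rw [Finset.sum_eq_single b (fun b' _ hb => by simp [hb]) (by simp)]
  by_cases ha : ψ a = c
  · simp [ha, h a b]
  · simp [ha]

lemma HasKernel.congr {P : Ω → ℝ} {f : Ω → A} {g : Ω → B} {W W' : B → A → ℝ}
    (h : HasKernel P f g W) (hW : ∀ b a, W b a = W' b a) : HasKernel P f g W' :=
  fun a b => by rw [h a b, hW]

lemma HasKernel.condEntropy_eq [Fintype A] [Fintype B] {P : Ω → ℝ} {f : Ω → A} {g : Ω → B}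
    {W : B → A → ℝ} (h : HasKernel P f g W) (hP : ∀ ω, 0 ≤ P ω) :
    condEntropy P f g = ∑ ω, P ω * -Real.logb 2 (W (g ω) (f ω)) := by
  rw [condEntropy_eq_sum hP]
  refine Finset.sum_congr rfl fun ω _ => ?_
  by_cases hω : P ω = 0
  · simp [hω]
  rw [h, mul_div_cancel_left₀ _ (pmfOf_self_pos hP g hω).ne']

/-- If the kernel of `f` given `g` depends on `φ ∘ g` only, then so does the conditional
entropy. -/
lemma HasKernel.condEntropy_comp [Fintype A] [Fintype B] [Fintype C] {P : Ω → ℝ} {f : Ω → A}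
    {g : Ω → B} {φ : B → C} {W : C → A → ℝ} (h : HasKernel P f g fun b => W (φ b))
    (hP : ∀ ω, 0 ≤ P ω) : condEntropy P f g = condEntropy P f (fun ω => φ (g ω)) := by
  rw [h.condEntropy_eq hP, h.comp_right.condEntropy_eq hP]

lemma HasKernel.kernel_self_ne_zero {P : Ω → ℝ} {f : Ω → A} {g : Ω → B}
    {W : B → A → ℝ} (h : HasKernel P f g W) (hP : ∀ ω, 0 ≤ P ω) {ω : Ω} (hω : P ω ≠ 0) :
    W (g ω) (f ω) ≠ 0 := by
  have := pmfOf_self_pos hP (fun ω => (f ω, g ω)) hω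
  rw [h] at this
  exact right_ne_zero_of_mul this.ne'

end Kernel

/-! ### Product laws -/

section Product

variable {ι A B : Type*} [Fintype ι] [DecidableEq ι] [Fintype A]

lemma pmfOf_prod_map (p : ι → A → ℝ) (φ : A → B) (b : ι → B) :
    pmfOf (fun f : ι → A => ∏ i, p i (f i)) (fun f i => φ (f i)) b
      = ∏ i, pmfOf (p i) φ (b i) := by
  classical
  simp only [pmfOf_eq]
  rw [Finset.prod_univ_sum, Fintype.piFinset_univ]
  refine Finset.sum_congr rfl fun f _ => ?_
  by_cases h : ∀ i, φ (f i) = b i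
  · simp [h]
  · rw [if_neg (fun h' => h fun i => congrFun h' i)]
    push Not at h
    obtain ⟨i, hi⟩ := h
    exact (Finset.prod_eq_zero (Finset.mem_univ i) (by simp [hi])).symm

lemma sum_prod_eq_one (p : ι → A → ℝ) (hp : ∀ i, ∑ a, p i a = 1) :
    ∑ f : ι → A, ∏ i, p i (f i) = 1 := by
  rw [← Fintype.piFinset_univ, ← Finset.prod_univ_sum]
  simp [hp]

lemma pmfOf_prod_eval (p : ι → A → ℝ) (hp : ∀ i, ∑ a, p i a = 1) (i : ι) (a : A) :
    pmfOf (fun f : ι → A => ∏ j, p j (f j)) (fun f => f i) a = p i a := by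
  classical
  -- The indicator of `f i = a` is written as a product over all coordinates, so that the sum
  -- factorises and every factor but the `i`-th is 1.
  have h := Finset.prod_univ_sum (fun _ : ι => (Finset.univ : Finset A))
    (fun j b => p j b * if j = i then (if b = a then 1 else 0) else 1)
  rw [Fintype.piFinset_univ] at h
  rw [pmfOf_eq]
  trans ∏ j, ∑ b, p j b * if j = i then (if b = a then 1 else 0) else 1
  · rw [h]
    refine Finset.sum_congr rfl fun f _ => ?_
    rw [Finset.prod_mul_distrib, Finset.prod_ite_eq' Finset.univ i]
    simp
  · rw [Finset.prod_eq_single i]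
    · simp
    · intro j _ hj
      simp [hj, hp]
    · simp

end Product

/-! ### Averaged single-letter laws -/

section Average

variable {Ω T A B : Type*} [Fintype Ω] {n : ℕ}

/-- `π` is the average of the laws of the letters `t₁, …, tₙ` (no condition if `n = 0`). -/
def IsAverage (P : Ω → ℝ) (t : Ω → Fin n → T) (π : T → ℝ) : Prop :=
  ∀ a, n * π a = ∑ i, pmfOf P (fun ω => t ω i) a

lemma IsAverage.expect [Fintype T] {P : Ω → ℝ} {t : Ω → Fin n → T} {π : T → ℝ} (h : IsAverage P t π)
    (φ : T → ℝ) : n * ∑ a, π a * φ a = ∑ i, ∑ ω, P ω * φ (t ω i) := by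
  simp only [← sum_pmfOf_mul P (fun ω => t ω _) φ]
  rw [Finset.mul_sum, Finset.sum_comm]
  refine Finset.sum_congr rfl fun a _ => ?_
  rw [← mul_assoc, h a, Finset.sum_mul]

lemma IsAverage.map [Fintype T] {P : Ω → ℝ} {t : Ω → Fin n → T} {π : T → ℝ} (h : IsAverage P t π)
    (φ : T → A) : IsAverage P (fun ω i => φ (t ω i)) (pmfOf π φ) := by
  classical
  intro a
  have := h.expect (fun x => if φ x = a then 1 else 0)
  simp only [mul_ite, mul_one, mul_zero, ← pmfOf_eq] at this
  exact this

lemma IsAverage.pos {P : Ω → ℝ} {t : Ω → Fin n → T} {π : T → ℝ} (h : IsAverage P t π)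
    (hP : ∀ ω, 0 ≤ P ω) {ω : Ω} (hω : P ω ≠ 0) (i : Fin n) : 0 < π (t ω i) := by
  have hn : (0 : ℝ) < n := by exact_mod_cast i.pos
  have : 0 < n * π (t ω i) := by
    rw [h]
    exact (pmfOf_self_pos hP (fun ω => t ω i) hω).trans_le
      (Finset.single_le_sum (f := fun j => pmfOf P (fun ω => t ω j) (t ω i))
        (fun j _ => pmfOf_nonneg hP _ _) (Finset.mem_univ i))
  exact pos_of_mul_pos_right this hn.le

lemma sum_mul_neg_logb_prod (P : Ω → ℝ) (w : Ω → Fin n → ℝ)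
    (hw : ∀ ω, P ω ≠ 0 → ∀ i, w ω i ≠ 0) :
    ∑ ω, P ω * -Real.logb 2 (∏ i, w ω i) = ∑ i, ∑ ω, P ω * -Real.logb 2 (w ω i) := by
  rw [Finset.sum_comm]
  refine Finset.sum_congr rfl fun ω _ => ?_
  by_cases hω : P ω = 0
  · simp [hω]
  simp only [Real.logb]
  rw [Real.log_prod (fun i _ => hw ω hω i), Finset.sum_div, ← Finset.mul_sum,
    ← Finset.sum_neg_distrib]

lemma exists_isAverage [Fintype T] {P : Ω → ℝ} (hP : P ∈ stdSimplex ℝ Ω) (t : Ω → Fin n → T)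
    (h : 0 < n ∨ Nonempty T) : ∃ π ∈ stdSimplex ℝ T, IsAverage P t π := by
  classical
  rcases Nat.eq_zero_or_pos n with rfl | hn
  -- With no letters any law is an average. This matters because a code may use the channel zero
  -- times.
  · obtain ⟨a⟩ := h.resolve_left (lt_irrefl 0)
    exact ⟨Pi.single a 1, single_mem_stdSimplex ℝ a, fun a => by simp⟩
  have hn' : (n : ℝ) ≠ 0 := by exact_mod_cast hn.ne'
  refine ⟨fun a => (∑ i, pmfOf P (fun ω => t ω i) a) / n, ⟨fun a => ?_, ?_⟩, fun a => ?_⟩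
  · exact div_nonneg (Finset.sum_nonneg fun i _ => pmfOf_nonneg hP.1 _ _) n.cast_nonneg
  · rw [← Finset.sum_div, Finset.sum_comm]
    simp [sum_pmfOf, hP.2, hn']
  · rw [mul_div_cancel₀ _ hn']

variable [Fintype T] [Fintype A] [Fintype B]

/-- The conditional entropy of blocks is at most `n` times that of the averaged letter. -/
lemma IsAverage.condEntropy_le {P : Ω → ℝ} {t : Ω → Fin n → T} {π : T → ℝ}
    (h : IsAverage P t π) (hP : ∀ ω, 0 ≤ P ω) (hπ : ∀ a, 0 ≤ π a) (α : T → A) (β : T → B) :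
    condEntropy P (fun ω i => α (t ω i)) (fun ω i => β (t ω i)) ≤ n * condEntropy π α β := by
  classical
  have hpos : ∀ ω, P ω ≠ 0 → ∀ i, 0 < condLaw π α β (β (t ω i)) (α (t ω i)) := fun ω hω i =>
    condLaw_self_pos hπ α β (h.pos hP hω i).ne'
  -- Comparing with the product of conditional laws of the averaged letter turns the bound into a
  -- sum of expectations of one fixed function of a letter. That sum is linear in the letter laws,
  -- so it equals `n` times the expectation under `π`.
  refine (condEntropy_le_cross hP _ _ (fun b a => ∏ i, condLaw π α β (b i) (a i))
    (fun b a => Finset.prod_nonneg fun i _ => condLaw_nonneg hπ _ _ _ _) (fun b => ?_)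
    fun ω hω => Finset.prod_pos fun i _ => hpos ω hω i).trans_eq ?_
  · rw [← Fintype.piFinset_univ, ← Finset.prod_univ_sum]
    exact Finset.prod_le_one
      (fun i _ => Finset.sum_nonneg fun a _ => condLaw_nonneg hπ _ _ _ _)
      fun i _ => sum_condLaw_le_one _ _ _ _
  · rw [sum_mul_neg_logb_prod P (fun ω i => condLaw π α β (β (t ω i)) (α (t ω i)))
      fun ω hω i => (hpos ω hω i).ne', condEntropy_eq_sum hπ,
      h.expect fun a => -Real.logb 2 (pmfOf π (fun ω => (α ω, β ω)) (α a, β a) / pmfOf π β (β a))]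
    rfl

/-- The entropy of a block is at most `n` times that of the averaged letter. -/
lemma IsAverage.entropy_le {P : Ω → ℝ} {t : Ω → Fin n → T} {π : T → ℝ}
    (h : IsAverage P t π) (hP : P ∈ stdSimplex ℝ Ω) (hπ : π ∈ stdSimplex ℝ T) (α : T → A) :
    entropy P (fun ω i => α (t ω i)) ≤ n * entropy π α := by
  have h1 := h.condEntropy_le hP.1 hπ.1 α (fun _ => ())
  have h2 : entropy P (fun ω i => α (t ω i)) = condEntropy P (fun ω i => α (t ω i))
      (fun ω (i : Fin n) => ()) := by
    unfold condEntropy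
    have : entropy P (fun _ (_ : Fin n) => ()) = 0 := by
      rw [entropy_eq_sum]
      have : pmfOf P (fun _ (_ : Fin n) => ()) (fun _ => ()) = 1 := by
        rw [pmfOf_eq]; simpa using hP.2
      simp [this]
    rw [this, sub_zero]
    exact entropy_congr_iff _ _ _ fun ω ω' => by simp
  rw [h2]
  exact h1.trans (mul_le_mul_of_nonneg_left (condEntropy_le_entropy hπ α _) n.cast_nonneg)

/-- For a memoryless kernel the conditional entropy of the block is `n` times that of the
averaged letter. -/
lemma IsAverage.condEntropy_eq {P : Ω → ℝ} {t : Ω → Fin n → T} {π : T → ℝ}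
    (h : IsAverage P t π) (hP : ∀ ω, 0 ≤ P ω) (hπ : ∀ a, 0 ≤ π a) {α : T → A} {β : T → B}
    {W : B → A → ℝ}
    (hk : HasKernel P (fun ω i => α (t ω i)) (fun ω i => β (t ω i))
      fun b a => ∏ i, W (b i) (a i))
    (hk1 : HasKernel π α β W) :
    condEntropy P (fun ω i => α (t ω i)) (fun ω i => β (t ω i)) = n * condEntropy π α β := by
  rw [hk.condEntropy_eq hP, hk1.condEntropy_eq hπ, h.expect,
    sum_mul_neg_logb_prod P (fun ω i => W (β (t ω i)) (α (t ω i)))]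
  intro ω hω i
  exact Finset.prod_ne_zero_iff.1 (hk.kernel_self_ne_zero hP hω) i (Finset.mem_univ i)

/-- The entropy of a memoryless block. -/
lemma IsAverage.entropy_eq {P : Ω → ℝ} {t : Ω → Fin n → T} {π : T → ℝ}
    (h : IsAverage P t π) (hP : ∀ ω, 0 ≤ P ω) {α : T → A} {p : A → ℝ}
    (hp : ∀ a, pmfOf P (fun ω i => α (t ω i)) a = ∏ i, p (a i))
    (hp1 : ∀ a, pmfOf π α a = p a) :
    entropy P (fun ω i => α (t ω i)) = n * entropy π α := by
  rw [entropy_eq_sum, entropy_eq_sum, h.expect fun a => -Real.logb 2 (pmfOf π α (α a))]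
  simp only [hp, hp1]
  refine sum_mul_neg_logb_prod P (fun ω i => p (α (t ω i))) fun ω hω i => ?_
  have := (pmfOf_self_pos hP (fun ω i => α (t ω i)) hω).ne'
  rw [hp] at this
  exact Finset.prod_ne_zero_iff.1 this i (Finset.mem_univ i)

end Average

/-! ### Data-processing bounds over a channel -/

section DataProcessing

variable {Ω F K X V Y Z : Type*} [Fintype Ω] [Fintype F] [Fintype K] [Fintype X] [Fintype V]
  [Fintype Y] [Fintype Z]

lemma condMutualInfo_eq_condEntropy (P : Ω → ℝ) (x : Ω → X) (y : Ω → Y) (z : Ω → Z) :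
    condMutualInfo P x y z = condEntropy P y z - condEntropy P y (fun ω => (x ω, z ω)) := by
  unfold condMutualInfo condEntropy
  rw [entropy_congr_iff P (fun ω => (x ω, y ω, z ω)) (fun ω => (y ω, x ω, z ω))
    fun ω ω' => by simp only [Prod.mk.injEq]; tauto]
  ring

/-- If the output `v`, equivalent to the pair `(y, z)`, depends on `(f, x)` through `x` only, then
`I(f ; y | z) ≤ I(x ; y | z)`. -/
lemma condMutualInfo_le_of_hasKernel {P : Ω → ℝ} (hP : ∀ ω, 0 ≤ P ω) {f : Ω → F} {x : Ω → X}
    {v : Ω → V} {W : X → V → ℝ} (h : HasKernel P v (fun ω => (f ω, x ω)) fun b => W b.2)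
    (α : V → Y) (β : V → Z) (hv : ∀ v v', α v = α v' → β v = β v' → v = v') :
    condMutualInfo P f (fun ω => α (v ω)) (fun ω => β (v ω)) ≤
      condMutualInfo P x (fun ω => α (v ω)) (fun ω => β (v ω)) := by
  have hv' : ∀ ω ω', v ω = v ω' ↔ α (v ω) = α (v ω') ∧ β (v ω) = β (v ω') := fun ω ω' =>
    ⟨fun e => by simp [e], fun e => hv _ _ e.1 e.2⟩
  rw [condMutualInfo_eq_condEntropy, condMutualInfo_eq_condEntropy]
  -- H(y|x,z) = H(v|x) - H(z|x). Neither term changes when `f` joins the conditioning, the second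
  -- because the kernel of z is a marginal of `W`. Hence H(y|x,z) = H(y|f,x,z) ≤ H(y|f,z).
  have h1 : condEntropy P v (fun ω => (f ω, x ω)) = condEntropy P v x :=
    h.condEntropy_comp hP
  have h2 : condEntropy P (fun ω => β (v ω)) (fun ω => (f ω, x ω))
      = condEntropy P (fun ω => β (v ω)) x :=
    HasKernel.condEntropy_comp (W := fun b => pmfOf (W b) β) (φ := Prod.snd)
      (h.comp_left β) hP
  have h3 := condEntropy_le_of_comp hP (fun ω => α (v ω)) (fun ω => ((f ω, x ω), β (v ω)))
    (fun t => (t.1.1, t.2))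
  unfold condEntropy at *
  rw [entropy_congr_iff P (fun ω => (α (v ω), (f ω, x ω), β (v ω))) (fun ω => (v ω, f ω, x ω))
      fun ω ω' => by simp only [Prod.mk.injEq, hv']; tauto,
    entropy_congr_iff P (fun ω => ((f ω, x ω), β (v ω))) (fun ω => (β (v ω), f ω, x ω))
      fun ω ω' => by simp only [Prod.mk.injEq]; tauto] at h3
  rw [entropy_congr_iff P (fun ω => (α (v ω), x ω, β (v ω))) (fun ω => (v ω, x ω))
      fun ω ω' => by simp only [Prod.mk.injEq, hv']; tauto,
    entropy_congr_iff P (fun ω => (x ω, β (v ω))) (fun ω => (β (v ω), x ω))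
      fun ω ω' => by simp only [Prod.mk.injEq]; tauto]
  dsimp only at *
  linarith

/-- Equivocation is at most the uncertainty left to a decoder with the key, plus the key size, plus
the secrecy rate of the channel. -/
lemma condEntropy_le_add_key {P : Ω → ℝ} (hP : P ∈ stdSimplex ℝ Ω) (f : Ω → F) (κ : Ω → K)
    (y : Ω → Y) (z : Ω → Z) :
    condEntropy P f z ≤ condEntropy P f (fun ω => (y ω, κ ω, z ω))
      + Real.logb 2 (Fintype.card K) + condMutualInfo P f y z := by
  -- By the chain rule H(f|y,z) = H(f|y,κ,z) + H(κ|y,z) - H(κ|f,y,z). The two facts below bound the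
  -- last two terms.
  have h1 := condEntropy_le_logb_card hP κ (fun ω => (y ω, z ω))
  have h2 := condEntropy_nonneg hP.1 κ (fun ω => (f ω, y ω, z ω))
  unfold condMutualInfo
  unfold condEntropy at *
  rw [entropy_congr_iff P (fun ω => (κ ω, y ω, z ω)) (fun ω => (y ω, κ ω, z ω))
      fun ω ω' => by simp only [Prod.mk.injEq]; tauto] at h1
  rw [entropy_congr_iff P (fun ω => (κ ω, f ω, y ω, z ω)) (fun ω => (f ω, y ω, κ ω, z ω))
      fun ω ω' => by simp only [Prod.mk.injEq]; tauto] at h2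
  linarith

/-- With a key independent of the message, the decoder gains at most the information carried by
the channel. -/
lemma mutualInfo_key_le {P : Ω → ℝ} (hP : ∀ ω, 0 ≤ P ω) {f : Ω → F} {κ : Ω → K} {x : Ω → X}
    {y : Ω → Y} {ν : K → ℝ} {W : X → Y → ℝ} (hκ : HasKernel P κ f fun _ => ν)
    (h : HasKernel P y (fun ω => (f ω, κ ω, x ω)) fun b => W b.2.2) :
    entropy P f - condEntropy P f (fun ω => (y ω, κ ω)) ≤ entropy P y - condEntropy P y x := by
  -- Since I(f;κ) = 0, I(f;y,κ) = I(f;y|κ) ≤ I(f,κ;y) ≤ I(f,κ,x;y) = I(x;y).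
  have h1 : condEntropy P κ f = condEntropy P κ (fun _ => ()) :=
    HasKernel.condEntropy_comp (W := fun _ => ν) (φ := fun _ => ()) hκ hP
  have h2 : condEntropy P κ y ≤ condEntropy P κ (fun _ => ()) :=
    condEntropy_le_of_comp hP κ y fun _ => ()
  have h3 : condEntropy P y (fun ω => (f ω, κ ω, x ω)) = condEntropy P y x :=
    HasKernel.condEntropy_comp (φ := fun b : F × K × X => b.2.2) h hP
  have h4 := condEntropy_le_of_comp hP y (fun ω => (f ω, κ ω, x ω)) (fun t => (t.1, t.2.1))
  unfold condEntropy at *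
  rw [entropy_congr_iff P (fun ω => (f ω, y ω, κ ω)) (fun ω => (y ω, f ω, κ ω))
      fun ω ω' => by simp only [Prod.mk.injEq]; tauto,
    entropy_congr_iff P (fun ω => (y ω, κ ω)) (fun ω => (κ ω, y ω))
      fun ω ω' => by simp only [Prod.mk.injEq]; tauto]
  rw [entropy_congr_iff P (fun ω => (κ ω, f ω)) (fun ω => (f ω, κ ω))
      fun ω ω' => by simp only [Prod.mk.injEq]; tauto] at h1
  dsimp only at *
  linarith

end DataProcessing

/-! ### Kernels and single-letter laws -/

section SingleLetter

variable {A B C : Type*} [Fintype A] [Fintype B]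

lemma inputOutput_mem_stdSimplex {p : A → ℝ} {q : A → B → ℝ} (hp : p ∈ stdSimplex ℝ A)
    (hq : IsStochastic q) : inputOutput p q ∈ stdSimplex ℝ (A × B) := by
  refine ⟨fun ω => mul_nonneg (hp.1 _) ((hq _).1 _), ?_⟩
  rw [Fintype.sum_prod_type]
  simp only [inputOutput, ← Finset.mul_sum, (hq _).2, mul_one, hp.2]

lemma hasKernel_inputOutput (p : A → ℝ) {q : A → B → ℝ} (hq : IsStochastic q) :
    (∀ a, pmfOf (inputOutput p q) Prod.fst a = p a) ∧
      HasKernel (inputOutput p q) Prod.snd Prod.fst q :=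
  hasKernel_of_bijective (Equiv.prodComm A B).bijective (fun _ => rfl) fun a => (hq a).2

lemma exists_kernel {π : A × B → ℝ} (hπ : π ∈ stdSimplex ℝ (A × B)) :
    ∃ q : A → B → ℝ, IsStochastic q ∧ π = inputOutput (pmfOf π Prod.fst) q := by
  classical
  have hsum : ∀ a, ∑ b, π (a, b) = pmfOf π Prod.fst a := by
    intro a
    rw [pmfOf_eq, Fintype.sum_prod_type, Finset.sum_eq_single a] <;> simp +contextual
  -- On rows of mass zero any law will do; the second marginal is one that is always at hand.
  refine ⟨fun a => if pmfOf π Prod.fst a = 0 then pmfOf π Prod.snd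
    else fun b => π (a, b) / pmfOf π Prod.fst a, fun a => ?_, ?_⟩
  · dsimp only
    split_ifs with h
    · exact pmfOf_mem_stdSimplex π hπ _
    · refine ⟨fun b => div_nonneg (hπ.1 _) (pmfOf_nonneg hπ.1 _ _), ?_⟩
      rw [← Finset.sum_div, hsum, div_self h]
  · funext ⟨a, b⟩
    unfold inputOutput
    dsimp only
    split_ifs with h
    · rw [h, zero_mul]
      rw [← hsum] at h
      exact (Finset.sum_eq_zero_iff_of_nonneg fun b _ => hπ.1 _).1 h b (Finset.mem_univ b)
    · rw [mul_div_cancel₀ _ h]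

lemma pmfOf_swap {Ω D E : Type*} [Fintype Ω] (P : Ω → ℝ) (f : Ω → D) (g : Ω → E) (a : D) (b : E) :
    pmfOf P (fun ω => (f ω, g ω)) (a, b) = pmfOf P (fun ω => (g ω, f ω)) (b, a) := by
  classical
  simp only [pmfOf_eq, Prod.mk.injEq, and_comm]

lemma HasKernel.of_pmfOf {Ω D : Type*} [Fintype Ω] {P : Ω → ℝ} {G : Ω → A} {f : A → C} {g : A → D}
    {W : D → C → ℝ} (h : HasKernel (pmfOf P G) f g W) :
    HasKernel P (fun ω => f (G ω)) (fun ω => g (G ω)) W := by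
  intro a b
  have := h a b
  rwa [pmfOf_pmfOf, pmfOf_pmfOf P G g] at this

/-- A memoryless channel used `n` times: the averaged law of input and output is the product of the
averaged input law with the channel. -/
lemma HasKernel.isAverage_inputOutput {Ω : Type*} [Fintype Ω] {n : ℕ} {P : Ω → ℝ}
    {x : Ω → Fin n → A} {v : Ω → Fin n → B} {Q : A → B → ℝ} (hQ : IsStochastic Q)
    (h : HasKernel P v x fun x v => ∏ j, Q (x j) (v j)) {pX : A → ℝ} (hpX : IsAverage P x pX) :
    IsAverage P (fun ω j => (x ω j, v ω j)) (inputOutput pX Q) := by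
  rintro ⟨a, b⟩
  -- The `j`-th coordinate of the product kernel is `Q (x j)`, which depends on the input word
  -- through its `j`-th letter only.
  have hj : ∀ j, HasKernel P (fun ω => v ω j) (fun ω => x ω j) Q := fun j =>
    HasKernel.comp_right (φ := fun x : Fin n → A => x j) <| (h.comp_left fun v => v j).congr
      fun x b => pmfOf_prod_eval (fun i => Q (x i)) (fun i => (hQ (x i)).2) j b
  unfold inputOutput
  rw [← mul_assoc, hpX a, Finset.sum_mul]
  exact Finset.sum_congr rfl fun j _ => by rw [pmfOf_swap, hj j]

end SingleLetter

/-! ### The law induced by a code -/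

section CodeLaw

variable {c : EncoderCase} {k n : ℕ} {S U Sh Uh X Y Z : Type*} [Fintype S] [Fintype U]
  [Fintype X] [Fintype Y] [Fintype Z]
  (C : Code c k n S U Sh Uh X Y) {p : S × U → ℝ} {Q : X → Y × Z → ℝ}

lemma Code.law_nonneg (hp : p ∈ stdSimplex ℝ (S × U)) (hQ : IsStochastic Q)
    (ω : Outcome k n C.keySize S U X Y Z) : 0 ≤ C.law p Q ω := by
  obtain ⟨s, u, κ, x, y, z⟩ := ω
  exact mul_nonneg (mul_nonneg (mul_nonneg (Finset.prod_nonneg fun i _ => hp.1 _)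
    (C.keyLaw_mem.1 _)) ((C.enc_mem _ _ _).1 _)) (Finset.prod_nonneg fun i _ => (hQ _).1 _)

/-- The law of source, key and channel input, and the channel as a kernel. -/
lemma Code.law_channel (p : S × U → ℝ) (hQ : IsStochastic Q) :
    (∀ b, pmfOf (C.law p Q) (fun ω => (ω.1, ω.2.1, ω.2.2.1, ω.2.2.2.1)) b =
      (∏ i, p (b.1 i, b.2.1 i)) * C.keyLaw b.2.2.1 * C.enc b.1 b.2.1 b.2.2.1 b.2.2.2) ∧
    HasKernel (C.law p Q) (fun ω j => (ω.2.2.2.2.1 j, ω.2.2.2.2.2 j))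
      (fun ω => (ω.1, ω.2.1, ω.2.2.1, ω.2.2.2.1))
      fun b v => ∏ j, Q (b.2.2.2 j) (v j) := by
  refine hasKernel_of_bijective
    (μ := fun b : (Fin k → S) × (Fin k → U) × Fin C.keySize × (Fin n → X) =>
      (∏ i, p (b.1 i, b.2.1 i)) * C.keyLaw b.2.2.1 * C.enc b.1 b.2.1 b.2.2.1 b.2.2.2)
    ⟨?_, ?_⟩ ?_ ?_
  · rintro ⟨s, u, κ, x, y, z⟩ ⟨s', u', κ', x', y', z'⟩ h
    simp only [Prod.mk.injEq, funext_iff] at h ⊢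
    obtain ⟨h1, h2⟩ := h
    exact ⟨h2.1, h2.2.1, h2.2.2.1, h2.2.2.2, fun j => (h1 j).1, fun j => (h1 j).2⟩
  · rintro ⟨v, s, u, κ, x⟩
    exact ⟨(s, u, κ, x, fun j => (v j).1, fun j => (v j).2), rfl⟩
  · rintro ⟨s, u, κ, x, y, z⟩
    rfl
  · intro b
    exact sum_prod_eq_one _ fun j => (hQ _).2

lemma Code.law_sourceKey (p : S × U → ℝ) (hQ : IsStochastic Q)
    (b : (Fin k → S) × (Fin k → U) × Fin C.keySize) :
    pmfOf (C.law p Q) (fun ω => (ω.1, ω.2.1, ω.2.2.1)) b =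
      (∏ i, p (b.1 i, b.2.1 i)) * C.keyLaw b.2.2 := by
  set μ := pmfOf (C.law p Q) (fun ω => (ω.1, ω.2.1, ω.2.2.1, ω.2.2.2.1)) with hμ
  have h := (hasKernel_of_bijective (P := μ) (f := fun b => b.2.2.2)
    (g := fun b => (b.1, b.2.1, b.2.2.1))
    (W := fun b x => C.enc b.1 b.2.1 b.2.2 x)
    (μ := fun b => (∏ i, p (b.1 i, b.2.1 i)) * C.keyLaw b.2.2)
    ⟨?_, ?_⟩ (C.law_channel p hQ).1 fun b => (C.enc_mem _ _ _).2).1 b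
  · rwa [hμ, pmfOf_pmfOf] at h
  · rintro ⟨s, u, κ, x⟩ ⟨s', u', κ', x'⟩ h
    simp only [Prod.mk.injEq] at h ⊢
    tauto
  · rintro ⟨x, s, u, κ⟩
    exact ⟨(s, u, κ, x), rfl⟩

/-- The source is memoryless and independent of the key. -/
lemma Code.law_source (p : S × U → ℝ) (hQ : IsStochastic Q) :
    (∀ b, pmfOf (C.law p Q) (fun ω i => (ω.1 i, ω.2.1 i)) b = ∏ i, p (b i)) ∧
    HasKernel (C.law p Q) (fun ω => ω.2.2.1) (fun ω i => (ω.1 i, ω.2.1 i))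
      fun _ => C.keyLaw := by
  set μ := pmfOf (C.law p Q) (fun ω => (ω.1, ω.2.1, ω.2.2.1)) with hμ
  have h := hasKernel_of_bijective (P := μ) (f := fun b => b.2.2)
    (g := fun b i => (b.1 i, b.2.1 i)) (W := fun _ => C.keyLaw)
    (μ := fun b => ∏ i, p (b i))
    ⟨?_, ?_⟩ (C.law_sourceKey p hQ) fun b => C.keyLaw_mem.2
  · refine ⟨fun b => ?_, h.2.of_pmfOf⟩
    rw [← h.1 b, hμ, pmfOf_pmfOf]
  · rintro ⟨s, u, κ⟩ ⟨s', u', κ'⟩ h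
    simp only [Prod.mk.injEq, funext_iff] at h ⊢
    exact ⟨fun i => (h.2 i).1, fun i => (h.2 i).2, h.1⟩
  · rintro ⟨κ, su⟩
    exact ⟨(fun i => (su i).1, fun i => (su i).2, κ), rfl⟩

lemma Code.law_mem (hp : p ∈ stdSimplex ℝ (S × U)) (hQ : IsStochastic Q) :
    C.law p Q ∈ stdSimplex ℝ (Outcome k n C.keySize S U X Y Z) := by
  refine ⟨C.law_nonneg hp hQ, ?_⟩
  rw [← sum_pmfOf (C.law p Q) (fun ω i => (ω.1 i, ω.2.1 i))]
  simp only [(C.law_source p hQ).1]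
  exact sum_prod_eq_one _ fun _ => hp.2

/-- If the encoder sees `U^k` only, then given everything else `S^k` is drawn from `U^k` by the
memoryless channel `p_{S|U}`. -/
lemma Code.law_semantic (hc : c = EncoderCase.observationOnly) {pU : U → ℝ} {q : U → S → ℝ}
    (hq : IsStochastic q) (hpq : ∀ s u, p (s, u) = pU u * q u s) :
    HasKernel (C.law p Q) (fun ω => ω.1) (fun ω => ω.2)
      fun b s => ∏ i, q (b.1 i) (s i) := by
  classical
  by_cases hS : Nonempty (Fin k → S)
  · obtain ⟨s₀⟩ := hS
    -- The encoder ignores the semantic word, so the arbitrary `s₀` may stand for it. Then only the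
    -- factors `q` involve the true word.
    refine (hasKernel_of_bijective (μ := fun b => (∏ i, pU (b.1 i)) * C.keyLaw b.2.1 *
      C.enc s₀ b.1 b.2.1 b.2.2.1 * ∏ j, Q (b.2.2.1 j) (b.2.2.2.1 j, b.2.2.2.2 j))
      Function.bijective_id ?_ ?_).2
    · rintro ⟨s, u, κ, x, y, z⟩
      simp only [Code.law, hpq, Finset.prod_mul_distrib, C.enc_observationOnly hc s s₀]
      ring
    · exact fun b => sum_prod_eq_one _ fun i => (hq _).2
  · intro s
    exact (hS ⟨s⟩).elim

end CodeLaw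

/-! ### Information carried by blocks over a memoryless channel. -/

section ChannelBlocks

variable {Ω A B Y Z : Type*} [Fintype Ω] [Fintype A] [Fintype B] [Fintype Y] [Fintype Z] {n : ℕ}
  {P : Ω → ℝ} {x : Ω → Fin n → A} {pX : A → ℝ}

lemma mutualInfo_eq_sub_condEntropy (P : Ω → ℝ) (f : Ω → A) (g : Ω → B) :
    mutualInfo P f g = entropy P g - condEntropy P g f := by
  unfold mutualInfo condEntropy
  rw [entropy_congr_iff P (fun ω => (f ω, g ω)) (fun ω => (g ω, f ω))
    fun ω ω' => by simp only [Prod.mk.injEq]; tauto]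
  ring

lemma HasKernel.expect {D : Type*} {P : Ω → ℝ} {f : Ω → A} {g : Ω → D} [Fintype D] {W : D → A → ℝ}
    (h : HasKernel P f g W) (φ : A → D → ℝ) :
    ∑ ω, P ω * φ (f ω) (g ω) = ∑ ω, P ω * ∑ a, W (g ω) a * φ a (g ω) := by
  rw [← sum_pmfOf_mul P (fun ω => (f ω, g ω)) (fun t => φ t.1 t.2),
    ← sum_pmfOf_mul P g (fun b => ∑ a, W b a * φ a b), Fintype.sum_prod_type_right]
  refine Finset.sum_congr rfl fun b _ => ?_
  rw [Finset.mul_sum]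
  exact Finset.sum_congr rfl fun a _ => by rw [h a b, mul_assoc]

/-- Information carried by `n` uses of a memoryless channel. -/
lemma HasKernel.block_mutualInfo_le {v : Ω → Fin n → B} {V : A → B → ℝ} (hV : IsStochastic V)
    (hP : P ∈ stdSimplex ℝ Ω) (hpX : pX ∈ stdSimplex ℝ A)
    (h : HasKernel P v x fun x v => ∏ j, V (x j) (v j)) (hav : IsAverage P x pX) :
    entropy P v - condEntropy P v x ≤ n * mutualInfo (inputOutput pX V) Prod.fst Prod.snd := by
  have hav' := h.isAverage_inputOutput hV hav
  have hπ := inputOutput_mem_stdSimplex hpX hV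
  have h1 := hav'.entropy_le hP hπ Prod.snd
  have h2 := hav'.condEntropy_eq hP.1 hπ.1 (α := Prod.snd) (β := Prod.fst) h
    (hasKernel_inputOutput pX hV).2
  rw [mutualInfo_eq_sub_condEntropy]
  change entropy P v ≤ _ at h1
  change condEntropy P v x = _ at h2
  linarith

/-- Secret information carried by `n` uses of a memoryless wiretap channel. -/
lemma HasKernel.block_condMutualInfo_le {v : Ω → Fin n → Y × Z} {Q : A → Y × Z → ℝ}
    (hQ : IsStochastic Q) (hP : P ∈ stdSimplex ℝ Ω) (hpX : pX ∈ stdSimplex ℝ A)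
    (h : HasKernel P v x fun x v => ∏ j, Q (x j) (v j)) (hav : IsAverage P x pX) :
    condMutualInfo P x (fun ω j => (v ω j).1) (fun ω j => (v ω j).2) ≤
      n * condMutualInfo (inputOutput pX Q) Prod.fst (fun t => t.2.1) (fun t => t.2.2) := by
  have hav' := h.isAverage_inputOutput hQ hav
  have hπ := inputOutput_mem_stdSimplex hpX hQ
  have hk := (hasKernel_inputOutput pX hQ).2
  -- I(x;y|z) = H(y|z) - H(y,z|x) + H(z|x). Memorylessness makes the last two terms exactly
  -- additive, so only H(y|z) needs an inequality.
  have h1 := hav'.condEntropy_le hP.1 hπ.1 (fun t => t.2.1) (fun t => t.2.2)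
  have h2 := hav'.condEntropy_eq hP.1 hπ.1 (α := Prod.snd) (β := Prod.fst) h hk
  have h3 := hav'.condEntropy_eq hP.1 hπ.1 (α := fun t => t.2.2) (β := Prod.fst)
    (W := fun b => pmfOf (Q b) Prod.snd)
    ((h.comp_left fun v j => (v j).2).congr fun x z =>
      pmfOf_prod_map (fun j => Q (x j)) Prod.snd z)
    (hk.comp_left Prod.snd)
  rw [condMutualInfo_eq_condEntropy, condMutualInfo_eq_condEntropy]
  unfold condEntropy at *
  dsimp only at *
  rw [entropy_congr_iff P (fun ω => (fun j => (v ω j).1, x ω, fun j => (v ω j).2))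
      (fun ω => (fun j => v ω j, fun j => x ω j))
      fun ω ω' => by simp only [funext_iff, Prod.ext_iff, forall_and]; tauto,
    entropy_congr_iff P (fun ω => (x ω, fun j => (v ω j).2))
      (fun ω => (fun j => (v ω j).2, fun j => x ω j))
      fun ω ω' => by simp only [Prod.mk.injEq, funext_iff]; tauto,
    entropy_congr_iff (inputOutput pX Q) (fun t => (t.2.1, t.1, t.2.2)) (fun t => (t.2, t.1))
      fun ω ω' => by simp only [Prod.ext_iff]; tauto,
    entropy_congr_iff (inputOutput pX Q) (fun t => (t.1, t.2.2)) (fun t => (t.2.2, t.1))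
      fun ω ω' => by simp only [Prod.mk.injEq]; tauto]
  linarith

end ChannelBlocks

/-- The information term of the semantic rate-distortion function, as a function of the joint law
of source and reconstruction letters. -/
noncomputable def semInfo {S U Sh Uh : Type*} [Fintype S] [Fintype U] [Fintype Sh] [Fintype Uh]
    (c : EncoderCase) (π : (S × U) × (Sh × Uh) → ℝ) : ℝ :=
  match c with
  | .observationOnly => mutualInfo π (fun t => t.1.2) (fun t => t.2)
  | .semanticAndObservation => mutualInfo π (fun t => t.1) (fun t => t.2)

/-! ### Bounds for one code in terms of the averaged laws `pX` and `π`. -/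

section CodeBounds

variable {c : EncoderCase} {k n : ℕ} {S U Sh Uh X Y Z : Type*} [Fintype S] [Fintype U]
  [Fintype X] [Fintype Y] [Fintype Z]
  (C : Code c k n S U Sh Uh X Y) {p : S × U → ℝ} {Q : X → Y × Z → ℝ}

/-- The source letters together with their reconstructions. -/
def Code.letters (ω : Outcome k n C.keySize S U X Y Z) (i : Fin k) : (S × U) × (Sh × Uh) :=
  ((ω.1 i, ω.2.1 i), (C.decS ω.2.2.2.2.1 ω.2.2.1 i, C.decU ω.2.2.2.2.1 ω.2.2.1 i))

/-- The equivocation of `f` is bounded by the uncertainty at the receiver, the key rate and the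
secrecy rate of the channel. -/
lemma Code.equivocation_le {F : Type*} [Fintype F] (f : (Fin k → S) × (Fin k → U) → F)
    (hp : p ∈ stdSimplex ℝ (S × U)) (hQ : IsStochastic Q) {pX : X → ℝ}
    (hpX : pX ∈ stdSimplex ℝ X) (hX : IsAverage (C.law p Q) (fun ω => ω.2.2.2.1) pX) :
    condEntropy (C.law p Q) (fun ω => f (ω.1, ω.2.1)) (fun ω => ω.2.2.2.2.2) ≤
      condEntropy (C.law p Q) (fun ω => f (ω.1, ω.2.1))
          (fun ω => (ω.2.2.2.2.1, ω.2.2.1, ω.2.2.2.2.2))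
        + Real.logb 2 C.keySize
        + n * condMutualInfo (inputOutput pX Q) Prod.fst (fun t => t.2.1) (fun t => t.2.2) := by
  have hP := C.law_mem hp hQ
  have hch := (C.law_channel p hQ).2
  have h1 := condEntropy_le_add_key hP (fun ω => f (ω.1, ω.2.1)) (fun ω => ω.2.2.1)
    (fun ω => ω.2.2.2.2.1) (fun ω => ω.2.2.2.2.2)
  have h2 := condMutualInfo_le_of_hasKernel hP.1 (f := fun ω => f (ω.1, ω.2.1))
    (x := fun ω => ω.2.2.2.1) (W := fun x v => ∏ j, Q (x j) (v j))
    (v := fun ω j => (ω.2.2.2.2.1 j, ω.2.2.2.2.2 j))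
    (hch.comp_right (W := fun (b : F × (Fin n → X)) (v : Fin n → Y × Z) => ∏ j, Q (b.2 j) (v j))
      (φ := fun b : (Fin k → S) × (Fin k → U) × Fin C.keySize × (Fin n → X) =>
        (f (b.1, b.2.1), b.2.2.2)))
    (fun v j => (v j).1) (fun v j => (v j).2)
    fun v v' e1 e2 => funext fun j => Prod.ext (congrFun e1 j) (congrFun e2 j)
  have h3 := HasKernel.block_condMutualInfo_le hQ hP hpX
    (hch.comp_right (W := fun (x : Fin n → X) (v : Fin n → Y × Z) => ∏ j, Q (x j) (v j))
      (φ := fun b : (Fin k → S) × (Fin k → U) × Fin C.keySize × (Fin n → X) => b.2.2.2)) hX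
  rw [Fintype.card_fin] at h1
  dsimp only at h1 h2 h3
  linarith

/-- The receiver's information about `f` is bounded by the information carried by the channel. -/
lemma Code.receiver_info_le {F : Type*} [Fintype F] (f : (Fin k → S × U) → F)
    {V : X → Y → ℝ} (hV : IsStochastic V) (hQV : ∀ x y, pmfOf (Q x) Prod.fst y = V x y)
    (hp : p ∈ stdSimplex ℝ (S × U)) (hQ : IsStochastic Q) {pX : X → ℝ}
    (hpX : pX ∈ stdSimplex ℝ X) (hX : IsAverage (C.law p Q) (fun ω => ω.2.2.2.1) pX) :
    entropy (C.law p Q) (fun ω => f fun i => (ω.1 i, ω.2.1 i)) -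
        condEntropy (C.law p Q) (fun ω => f fun i => (ω.1 i, ω.2.1 i))
          (fun ω => (ω.2.2.2.2.1, ω.2.2.1)) ≤
      n * mutualInfo (inputOutput pX V) Prod.fst Prod.snd := by
  have hP := C.law_mem hp hQ
  have hy : HasKernel (C.law p Q) (fun ω => ω.2.2.2.2.1)
      (fun ω => (ω.1, ω.2.1, ω.2.2.1, ω.2.2.2.1))
      fun b y => ∏ j, V (b.2.2.2 j) (y j) :=
    ((C.law_channel p hQ).2.comp_left fun v j => (v j).1).congr fun b y => by
      rw [pmfOf_prod_map (fun j => Q (b.2.2.2 j)) Prod.fst y]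
      simp only [hQV]
  have hκ := (C.law_source p hQ).2.comp_right (φ := f) (W := fun _ => C.keyLaw)
  refine (mutualInfo_key_le hP.1 (x := fun ω => ω.2.2.2.1) hκ
    (W := fun x y => ∏ j, V (x j) (y j))
    (hy.comp_right (W := fun (b : F × Fin C.keySize × (Fin n → X)) (y : Fin n → Y) =>
        ∏ j, V (b.2.2 j) (y j))
      (φ := fun b : (Fin k → S) × (Fin k → U) × Fin C.keySize × (Fin n → X) =>
        (f fun i => (b.1 i, b.2.1 i), b.2.2.1, b.2.2.2)))).trans ?_
  exact HasKernel.block_mutualInfo_le hV hP hpX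
    (hy.comp_right (W := fun (x : Fin n → X) (y : Fin n → Y) => ∏ j, V (x j) (y j))
      (φ := fun b : (Fin k → S) × (Fin k → U) × Fin C.keySize × (Fin n → X) => b.2.2.2)) hX

variable {π : (S × U) × (Sh × Uh) → ℝ}

section Source

variable [Fintype Sh] [Fintype Uh]

lemma Code.source_marginal (hk : 0 < k) (hp : p ∈ stdSimplex ℝ (S × U)) (hQ : IsStochastic Q)
    (hA : IsAverage (C.law p Q) C.letters π) : pmfOf π Prod.fst = p := by
  funext a
  have h := hA.map Prod.fst a
  have hk' : (k : ℝ) ≠ 0 := by exact_mod_cast hk.ne'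
  have : ∀ i, pmfOf (C.law p Q) (fun ω => (C.letters ω i).1) a = p a := by
    intro i
    have e := pmfOf_pmfOf (C.law p Q) (fun ω i => (ω.1 i, ω.2.1 i)) (fun su => su i) a
    rw [funext (C.law_source p hQ).1, pmfOf_prod_eval (fun _ => p) (fun _ => hp.2)] at e
    exact e.symm
  simp only [this, Finset.sum_const, Finset.card_univ, Fintype.card_fin, nsmul_eq_mul] at h
  exact mul_left_cancel₀ hk' h

lemma Code.expect_letters (hk : 0 < k) (hA : IsAverage (C.law p Q) C.letters π)
    (φ : (S × U) × (Sh × Uh) → ℝ) :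
    ∑ t, π t * φ t = ∑ ω, C.law p Q ω * ((1 / (k : ℝ)) * ∑ i, φ (C.letters ω i)) := by
  have hk' : (k : ℝ) ≠ 0 := by exact_mod_cast hk.ne'
  apply mul_left_cancel₀ hk'
  rw [hA.expect, Finset.mul_sum, Finset.sum_comm]
  refine Finset.sum_congr rfl fun ω _ => ?_
  rw [← Finset.mul_sum]
  field_simp

/-- Given everything else, including the reconstruction, S_i is drawn from p_{S|U} at U_i. Averaging
`dS` over this draw produces `modifiedDist`. -/
lemma Code.expect_modifiedDist (hk : 0 < k) (hp : p ∈ stdSimplex ℝ (S × U)) (hQ : IsStochastic Q)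
    (hA : IsAverage (C.law p Q) C.letters π) (hc : c = EncoderCase.observationOnly)
    (dS : S → Sh → ℝ) :
    ∑ t, π t * modifiedDist p dS t.1.2 t.2.1 = ∑ t, π t * dS t.1.1 t.2.1 := by
  obtain ⟨q, hq, hpq'⟩ := exists_kernel (pmfOf_mem_stdSimplex p hp Prod.swap)
  have hpq : ∀ s u, p (s, u) = pmfOf p Prod.snd u * q u s := by
    intro s u
    have h1 := pmfOf_of_injective p Prod.swap_injective (s, u)
    have h2 := pmfOf_pmfOf p Prod.swap Prod.fst u
    rw [hpq'] at h1
    unfold inputOutput at h1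
    simp only [Prod.swap_prod_mk, Prod.fst_swap] at h1 h2
    rw [h2] at h1
    exact h1.symm
  have hsem := C.law_semantic (Q := Q) hc hq hpq
  have hk' : (k : ℝ) ≠ 0 := by exact_mod_cast hk.ne'
  apply mul_left_cancel₀ hk'
  rw [hA.expect (fun t => modifiedDist p dS t.1.2 t.2.1), hA.expect (fun t => dS t.1.1 t.2.1)]
  refine Finset.sum_congr rfl fun i _ => ?_
  have hi := (hsem.comp_left fun s => s i).expect
    fun a b => dS a (C.decS b.2.2.2.1 b.2.1 i)
  refine Eq.trans ?_ hi.symm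
  refine Finset.sum_congr rfl fun ω _ => ?_
  by_cases hω : C.law p Q ω = 0
  · simp [hω]
  -- On the support p_U(U_i) is positive, so the quotient in `modifiedDist` is a genuine conditional
  -- probability.
  have hpos := (pmfOf_self_pos (C.law_nonneg hp hQ) (fun ω i => (ω.1 i, ω.2.1 i)) hω).ne'
  rw [(C.law_source p hQ).1] at hpos
  have hpi := Finset.prod_ne_zero_iff.1 hpos i (Finset.mem_univ i)
  rw [hpq] at hpi
  congr 1
  refine Finset.sum_congr rfl fun s _ => ?_
  rw [pmfOf_prod_eval (fun i => q (ω.2.1 i)) (fun i => (hq _).2) i s, hpq s]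
  simp only [Code.letters]
  rw [mul_div_cancel_left₀ _ (left_ne_zero_of_mul hpi)]

/-- The reconstruction is a function of what the receiver holds, so it leaves at least as much
uncertainty about the source. Averaging over letters bounds that uncertainty by k(H(S) - I(S;Ŝ))
under `π`. -/
lemma Code.equivS_le (hk : 0 < k) (hp : p ∈ stdSimplex ℝ (S × U)) (hQ : IsStochastic Q)
    (hA : IsAverage (C.law p Q) C.letters π) (hπ : π ∈ stdSimplex ℝ _) {pX : X → ℝ}
    (hpX : pX ∈ stdSimplex ℝ X) (hX : IsAverage (C.law p Q) (fun ω => ω.2.2.2.1) pX) :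
    k * C.equivS p Q ≤ k * (entropy p Prod.fst -
        mutualInfo π (fun t => t.1.1) (fun t => t.2.1)) + Real.logb 2 C.keySize +
      n * condMutualInfo (inputOutput pX Q) Prod.fst (fun t => t.2.1) (fun t => t.2.2) := by
  have hk' : (k : ℝ) ≠ 0 := by exact_mod_cast hk.ne'
  have hP := C.law_mem hp hQ
  have h1 := C.equivocation_le (fun su => su.1) hp hQ hpX hX
  have h2 := condEntropy_le_of_comp hP.1 (fun ω => ω.1)
    (fun ω => (ω.2.2.2.2.1, ω.2.2.1, ω.2.2.2.2.2)) (fun t i => C.decS t.1 t.2.1 i)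
  have h3 := hA.condEntropy_le hP.1 hπ.1 (fun t => t.1.1) (fun t => t.2.1)
  have h4 : entropy p Prod.fst = entropy π (fun t => t.1.1) := by
    rw [← C.source_marginal hk hp hQ hA, entropy_pmfOf]
  unfold Code.equivS
  rw [← mul_assoc, mul_one_div_cancel hk', one_mul, h4]
  unfold mutualInfo
  simp only [Code.letters] at h1 h2 h3 ⊢
  linarith

lemma Code.equivU_le (hk : 0 < k) (hp : p ∈ stdSimplex ℝ (S × U)) (hQ : IsStochastic Q)
    (hA : IsAverage (C.law p Q) C.letters π) (hπ : π ∈ stdSimplex ℝ _) {pX : X → ℝ}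
    (hpX : pX ∈ stdSimplex ℝ X) (hX : IsAverage (C.law p Q) (fun ω => ω.2.2.2.1) pX) :
    k * C.equivU p Q ≤ k * (entropy p Prod.snd -
        mutualInfo π (fun t => t.1.2) (fun t => t.2.2)) + Real.logb 2 C.keySize +
      n * condMutualInfo (inputOutput pX Q) Prod.fst (fun t => t.2.1) (fun t => t.2.2) := by
  have hk' : (k : ℝ) ≠ 0 := by exact_mod_cast hk.ne'
  have hP := C.law_mem hp hQ
  have h1 := C.equivocation_le (fun su => su.2) hp hQ hpX hX
  have h2 := condEntropy_le_of_comp hP.1 (fun ω => ω.2.1)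
    (fun ω => (ω.2.2.2.2.1, ω.2.2.1, ω.2.2.2.2.2)) (fun t i => C.decU t.1 t.2.1 i)
  have h3 := hA.condEntropy_le hP.1 hπ.1 (fun t => t.1.2) (fun t => t.2.2)
  have h4 : entropy p Prod.snd = entropy π (fun t => t.1.2) := by
    rw [← C.source_marginal hk hp hQ hA, entropy_pmfOf]
  unfold Code.equivU
  rw [← mul_assoc, mul_one_div_cancel hk', one_mul, h4]
  unfold mutualInfo
  simp only [Code.letters] at h1 h2 h3 ⊢
  linarith

lemma Code.equivSU_le (hk : 0 < k) (hp : p ∈ stdSimplex ℝ (S × U)) (hQ : IsStochastic Q)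
    (hA : IsAverage (C.law p Q) C.letters π) (hπ : π ∈ stdSimplex ℝ _) {pX : X → ℝ}
    (hpX : pX ∈ stdSimplex ℝ X) (hX : IsAverage (C.law p Q) (fun ω => ω.2.2.2.1) pX) :
    k * C.equivSU p Q ≤ k * (entropy p id - semInfo c π) + Real.logb 2 C.keySize +
      n * condMutualInfo (inputOutput pX Q) Prod.fst (fun t => t.2.1) (fun t => t.2.2) := by
  have hk' : (k : ℝ) ≠ 0 := by exact_mod_cast hk.ne'
  have hP := C.law_mem hp hQ
  have h1 := C.equivocation_le (fun su => su) hp hQ hpX hX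
  have h4 : entropy p id = entropy π (fun t => t.1) := by
    rw [← C.source_marginal hk hp hQ hA, entropy_pmfOf]; rfl
  unfold Code.equivSU
  rw [← mul_assoc, mul_one_div_cancel hk', one_mul, h4]
  suffices h : condEntropy (C.law p Q) (fun ω => (ω.1, ω.2.1))
      (fun ω => (ω.2.2.2.2.1, ω.2.2.1, ω.2.2.2.2.2)) ≤
      k * (entropy π (fun t => t.1) - semInfo c π) by
    linarith
  cases c with
  | observationOnly =>
    -- Chain rule: U^k given the receiver's data costs at most k H(U|Ŝ,Û), and S^k given U^k and
    -- those data at most k H(S|U). The sum is k(H(S,U) - I(U;Ŝ,Û)).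
    have h2 := condEntropy_le_of_comp hP.1 (fun ω => ω.2.1)
      (fun ω => (ω.2.2.2.2.1, ω.2.2.1, ω.2.2.2.2.2))
      (fun t i => (C.decS t.1 t.2.1 i, C.decU t.1 t.2.1 i))
    have h3 := hA.condEntropy_le hP.1 hπ.1 (fun t => t.1.2) (fun t => t.2)
    have h5 := condEntropy_le_of_comp hP.1 (fun ω => ω.1)
      (fun ω => (ω.2.1, (ω.2.2.2.2.1, ω.2.2.1, ω.2.2.2.2.2))) (fun t => t.1)
    have h6 := hA.condEntropy_le hP.1 hπ.1 (fun t => t.1.1) (fun t => t.1.2)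
    simp only [Code.letters, semInfo, mutualInfo, condEntropy, mul_sub] at h2 h3 h5 h6 ⊢
    rw [entropy_congr_iff (C.law p Q)
      (fun ω => ((ω.1, ω.2.1), ω.2.2.2.2.1, ω.2.2.1, ω.2.2.2.2.2))
      (fun ω => (ω.1, ω.2.1, ω.2.2.2.2.1, ω.2.2.1, ω.2.2.2.2.2))
      fun ω ω' => by simp only [Prod.mk.injEq]; tauto]
    linarith
  | semanticAndObservation =>
    have h2 := condEntropy_le_of_comp hP.1 (fun ω => (ω.1, ω.2.1))
      (fun ω => (ω.2.2.2.2.1, ω.2.2.1, ω.2.2.2.2.2))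
      (fun t i => (C.decS t.1 t.2.1 i, C.decU t.1 t.2.1 i))
    have h3 := hA.condEntropy_le hP.1 hπ.1 (fun t => t.1) (fun t => t.2)
    simp only [Code.letters, semInfo, mutualInfo, condEntropy, mul_sub] at h2 h3 ⊢
    rw [entropy_congr_iff (C.law p Q)
      (fun ω => ((ω.1, ω.2.1), fun i => (C.decS ω.2.2.2.2.1 ω.2.2.1 i, C.decU ω.2.2.2.2.1 ω.2.2.1 i)))
      (fun ω => (fun i => (ω.1 i, ω.2.1 i),
        fun i => (C.decS ω.2.2.2.2.1 ω.2.2.1 i, C.decU ω.2.2.2.2.1 ω.2.2.1 i)))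
      fun ω ω' => by simp only [Prod.mk.injEq, funext_iff, forall_and]] at h2
    linarith

/-- The source is memoryless, so its block entropy is exactly `k` letter entropies. Subtracting the
single-letter bound on the uncertainty given the reconstructions gives k I ≤ I(source;Y^n,K), which
the channel limits. In Case 1 the source block is U^k alone. -/
lemma Code.semInfo_le (hk : 0 < k) {V : X → Y → ℝ} (hV : IsStochastic V)
    (hQV : ∀ x y, pmfOf (Q x) Prod.fst y = V x y)
    (hp : p ∈ stdSimplex ℝ (S × U)) (hQ : IsStochastic Q)
    (hA : IsAverage (C.law p Q) C.letters π) (hπ : π ∈ stdSimplex ℝ _) {pX : X → ℝ}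
    (hpX : pX ∈ stdSimplex ℝ X) (hX : IsAverage (C.law p Q) (fun ω => ω.2.2.2.1) pX) :
    k * semInfo c π ≤ n * mutualInfo (inputOutput pX V) Prod.fst Prod.snd := by
  have hP := C.law_mem hp hQ
  have hmarg := C.source_marginal hk hp hQ hA
  have hsrc := (C.law_source p hQ).1
  cases c with
  | observationOnly =>
    refine le_trans ?_ (C.receiver_info_le (fun su i => (su i).2) hV hQV hp hQ hpX hX)
    have h2 := condEntropy_le_of_comp hP.1 (fun ω => ω.2.1)
      (fun ω => (ω.2.2.2.2.1, ω.2.2.1))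
      (fun t i => (C.decS t.1 t.2 i, C.decU t.1 t.2 i))
    have h3 := hA.condEntropy_le hP.1 hπ.1 (fun t => t.1.2) (fun t => t.2)
    have h4 := hA.entropy_eq hP.1 (α := fun t => t.1.2) (p := pmfOf p Prod.snd)
      (fun a => by
        rw [← pmfOf_prod_map (fun _ => p) Prod.snd a, ← funext hsrc, pmfOf_pmfOf]
        rfl)
      (fun a => by rw [← hmarg, pmfOf_pmfOf])
    simp only [Code.letters, semInfo, mutualInfo, mul_sub] at h2 h3 h4 ⊢
    linarith
  | semanticAndObservation =>
    refine le_trans ?_ (C.receiver_info_le (fun su => su) hV hQV hp hQ hpX hX)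
    have h2 := condEntropy_le_of_comp hP.1 (fun ω i => (ω.1 i, ω.2.1 i))
      (fun ω => (ω.2.2.2.2.1, ω.2.2.1))
      (fun t i => (C.decS t.1 t.2 i, C.decU t.1 t.2 i))
    have h3 := hA.condEntropy_le hP.1 hπ.1 (fun t => t.1) (fun t => t.2)
    have h4 := hA.entropy_eq hP.1 (α := fun t => t.1) hsrc
      (fun a => congrFun hmarg a)
    simp only [Code.letters, semInfo, mutualInfo, mul_sub] at h2 h3 h4 ⊢
    linarith

end Source

end CodeBounds

/-! ### The maxima over auxiliary variables -/

section Auxiliary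

variable {X Y Z T : Type*} [Fintype X] [Fintype Y] [Fintype Z] [Fintype T]
  {c : EncoderCase} {pX : X → ℝ} {Q : X → Y × Z → ℝ}

lemma IsAuxLaw.nonneg {w : Label X × Label X × X → ℝ} (hw : IsAuxLaw c pX w)
    (ω : Label X × Label X × X) : 0 ≤ w ω := by
  obtain ⟨a, b, x⟩ := ω
  obtain ⟨-, -, h⟩ := hw
  cases c with
  | observationOnly =>
    obtain ⟨pA, qB, qX, hA, hB, hX, e⟩ := h
    rw [e]
    exact mul_nonneg (mul_nonneg (hA.1 _) ((hB _).1 _)) ((hX _).1 _)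
  | semanticAndObservation =>
    obtain ⟨pAB, qX, hA, hX, e⟩ := h
    rw [e]
    exact mul_nonneg (hA.1 _) ((hX _).1 _)

lemma auxLaw_hasKernel (hQ : IsStochastic Q) (w : Label X × Label X × X → ℝ) :
    (∀ b, pmfOf (auxLaw w Q) (fun ω => (ω.1, ω.2.1)) b = w (b.1.1, b.1.2, b.2)) ∧
    HasKernel (auxLaw w Q) (fun ω => ω.2.2) (fun ω => (ω.1, ω.2.1)) fun b => Q b.2 := by
  refine hasKernel_of_bijective (μ := fun b : (Label X × Label X) × X => w (b.1.1, b.1.2, b.2))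
    ⟨?_, ?_⟩ ?_ fun b => (hQ _).2
  · rintro ⟨⟨a, b⟩, x, y, z⟩ ⟨⟨a', b'⟩, x', y', z'⟩ h
    simp only [Prod.mk.injEq] at h ⊢
    tauto
  · rintro ⟨v, ab, x⟩
    exact ⟨(ab, x, v), rfl⟩
  · rintro ⟨⟨a, b⟩, x, y, z⟩
    rfl

/-- The law of input and outputs does not depend on the auxiliary variables. -/
lemma pmfOf_auxLaw (hQ : IsStochastic Q) {w : Label X × Label X × X → ℝ}
    (hw : pmfOf w (fun ω => ω.2.2) = pX) :
    pmfOf (auxLaw w Q) (fun ω => ω.2) = inputOutput pX Q := by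
  obtain ⟨h1, h2⟩ := auxLaw_hasKernel hQ w
  have hx : ∀ x, pmfOf (auxLaw w Q) (fun ω => ω.2.1) x = pX x := by
    classical
    intro x
    rw [← pmfOf_pmfOf (auxLaw w Q) (fun ω => (ω.1, ω.2.1)) Prod.snd x, funext h1, ← hw,
      pmfOf_eq, pmfOf_eq]
    exact Fintype.sum_equiv (Equiv.prodAssoc _ _ _) _ _ fun b => rfl
  have hk : HasKernel (auxLaw w Q) (fun ω => ω.2.2) (fun ω => ω.2.1) Q :=
    HasKernel.comp_right (φ := fun b : (Label X × Label X) × X => b.2) h2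
  funext ⟨x, v⟩
  have := hk v x
  rw [hx, pmfOf_swap] at this
  exact this

lemma condMutualInfo_auxLaw (hQ : IsStochastic Q) {w : Label X × Label X × X → ℝ}
    (hw : pmfOf w (fun ω => ω.2.2) = pX) :
    condMutualInfo (auxLaw w Q) (fun ω => ω.2.1) (fun ω => ω.2.2.1) (fun ω => ω.2.2.2) =
      condMutualInfo (inputOutput pX Q) Prod.fst (fun t => t.2.1) (fun t => t.2.2) := by
  unfold condMutualInfo condEntropy
  simp only [← pmfOf_auxLaw hQ hw, entropy_pmfOf]

/-- Data processing along (W_s,W_u) → X → (Y,Z), a chain that holds in both cases. -/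
lemma secrecyValues_le (hQ : IsStochastic Q) (g : Label X × Label X → T) {v : ℝ}
    (hv : v ∈ secrecyValues c pX Q g) :
    v ≤ condMutualInfo (inputOutput pX Q) Prod.fst (fun t => t.2.1) (fun t => t.2.2) := by
  obtain ⟨w, hw, rfl⟩ := hv
  have hn : ∀ ω, 0 ≤ auxLaw w Q ω := fun ω => mul_nonneg (hw.nonneg _) ((hQ _).1 _)
  rw [← condMutualInfo_auxLaw hQ hw.1]
  exact condMutualInfo_le_of_hasKernel hn (f := fun ω => g ω.1) (x := fun ω => ω.2.1)
    (v := fun ω => ω.2.2) (W := Q)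
    (HasKernel.comp_right (W := fun b : T × X => Q b.2)
      (φ := fun b : (Label X × Label X) × X => (g b.1, b.2)) (auxLaw_hasKernel hQ w).2)
    Prod.fst Prod.snd fun v v' => Prod.ext

/-- Both auxiliary variables may be taken to be copies of the channel input. -/
lemma exists_auxLaw_diagonal [Nonempty X] (c : EncoderCase) (hpX : pX ∈ stdSimplex ℝ X) :
    ∃ (w : Label X × Label X × X → ℝ) (e : X → Label X), IsAuxLaw c pX w ∧
      Function.Injective e ∧ ∀ a b x, w (a, b, x) ≠ 0 → a = e x ∧ b = e x := by
  classical
  let e : X → Label X := fun x => (Fintype.equivFin X x).castSucc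
  have he : Function.Injective e := fun x x' h => by simpa [e] using h
  -- The values of `e'` off the range of `e` are arbitrary but harmless, as `pA` has no mass there.
  let e' : Label X → X := Function.invFun e
  have hee : ∀ x, e' (e x) = x := Function.leftInverse_invFun he
  let pA : Label X → ℝ := pmfOf pX e
  have hpA := pmfOf_mem_stdSimplex pX hpX e
  let qB : Label X → Label X → ℝ := fun a => Pi.single a 1
  let qX : Label X → X → ℝ := fun b => Pi.single (e' b) 1
  have hqB : IsStochastic qB := fun a => single_mem_stdSimplex ℝ a
  have hqX : IsStochastic qX := fun a => single_mem_stdSimplex ℝ (e' a)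
  have hsupp : ∀ a b x, pA a * qB a b * qX b x ≠ 0 → a = e x ∧ b = e x := by
    intro a b x h
    have h1 : b = a := by
      by_contra hab
      exact h (by simp [qB, hab])
    have h2 : x = e' b := by
      by_contra hxb
      exact h (by simp [qX, hxb])
    subst h1
    obtain ⟨x', hx'⟩ : ∃ x', e x' = b := by
      by_contra hne
      push Not at hne
      exact h (by simp [pA, pmfOf_eq, hne])
    rw [h2, ← hx', hee]
    exact ⟨rfl, rfl⟩
  refine ⟨fun ω => pA ω.1 * qB ω.1 ω.2.1 * qX ω.2.1 ω.2.2, e, ⟨?_, ?_, ?_⟩, he, hsupp⟩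
  · funext x
    rw [pmfOf_eq]
    simp only [Fintype.sum_prod_type]
    trans ∑ a, pA a * qX a x
    · refine Finset.sum_congr rfl fun a _ => ?_
      rw [Finset.sum_eq_single a (fun b _ hb => by simp [qB, hb]) (by simp)]
      simp [qB]
    · rw [sum_pmfOf_mul pX e fun a => qX a x]
      simp [qX, hee, Pi.single_apply]
  -- The diagonal carries all the mass and has at most |𝒳| + 1 points, one per label.
  · refine ⟨Finset.univ.image fun a => (a, a),
      Finset.card_image_le.trans (by simp), fun a b x h => ?_⟩
    by_contra hne
    obtain ⟨h1, h2⟩ := hsupp a b x hne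
    exact h (by simp [h1, h2])
  · cases c with
    | observationOnly => exact ⟨pA, qB, qX, hpA, hqB, hqX, fun _ _ _ => rfl⟩
    | semanticAndObservation =>
      exact ⟨inputOutput pA qB, fun ab => qX ab.2, inputOutput_mem_stdSimplex hpA hqB,
        fun ab => hqX _, fun _ _ _ => rfl⟩

/-- The maximum over auxiliary variables is `I(X ; Y | Z)`. -/
lemma isGreatest_secrecyValues [Nonempty X] (c : EncoderCase) (hpX : pX ∈ stdSimplex ℝ X)
    (hQ : IsStochastic Q) (g : Label X × Label X → T)
    (hg : ∀ a b, g (a, a) = g (b, b) → a = b) :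
    IsGreatest (secrecyValues c pX Q g)
      (condMutualInfo (inputOutput pX Q) Prod.fst (fun t => t.2.1) (fun t => t.2.2)) := by
  refine ⟨?_, fun v hv => secrecyValues_le hQ g hv⟩
  obtain ⟨w, e, hw, he, hsupp⟩ := exists_auxLaw_diagonal c hpX
  refine ⟨w, hw, ?_⟩
  rw [← condMutualInfo_auxLaw hQ hw.1]
  -- On the support both auxiliaries equal `e x`, so `g` of the pair and the input determine each
  -- other and may be exchanged inside entropies.
  have hs : ∀ ω ω', auxLaw w Q ω ≠ 0 → auxLaw w Q ω' ≠ 0 →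
      (ω.2.1 = ω'.2.1 ↔ g ω.1 = g ω'.1) := by
    rintro ⟨⟨a, b⟩, x, y, z⟩ ⟨⟨a', b'⟩, x', y', z'⟩ h h'
    obtain ⟨rfl, rfl⟩ := hsupp a b x (left_ne_zero_of_mul h)
    obtain ⟨rfl, rfl⟩ := hsupp a' b' x' (left_ne_zero_of_mul h')
    exact ⟨fun e => by rw [show x = x' from e], fun e => he (hg _ _ e)⟩
  unfold condMutualInfo condEntropy
  rw [entropy_congr_support (auxLaw w Q) (fun ω => (ω.2.1, ω.2.2.2)) (fun ω => (g ω.1, ω.2.2.2))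
      fun ω ω' h h' => by simp only [Prod.mk.injEq, hs ω ω' h h'],
    entropy_congr_support (auxLaw w Q) (fun ω => (ω.2.1, ω.2.2.1, ω.2.2.2))
      (fun ω => (g ω.1, ω.2.2.1, ω.2.2.2))
      fun ω ω' h h' => by simp only [Prod.mk.injEq, hs ω ω' h h']]

end Auxiliary

/-! ### Continuity and compactness -/

section Continuity

variable {Ω A B C : Type*} [Fintype Ω] [Fintype A] [Fintype B] [Fintype C]

lemma continuous_pmfOf {D : Type*} (f : Ω → D) (a : D) : Continuous fun P : Ω → ℝ => pmfOf P f a := by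
  classical
  simp only [pmfOf_eq]
  refine continuous_finsetSum _ fun ω _ => ?_
  split_ifs <;> fun_prop

lemma continuous_entropy (f : Ω → A) : Continuous fun P : Ω → ℝ => entropy P f := by
  unfold entropy
  refine (continuous_finsetSum _ fun a _ => ?_).neg
  simp only [Real.logb, ← mul_div_assoc]
  exact (Real.continuous_mul_log.comp (continuous_pmfOf f a)).div_const _

lemma continuous_mutualInfo (f : Ω → A) (g : Ω → B) :
    Continuous fun P : Ω → ℝ => mutualInfo P f g :=
  (continuous_entropy f).sub ((continuous_entropy _).sub (continuous_entropy g))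

lemma continuous_condMutualInfo (f : Ω → A) (g : Ω → B) (h : Ω → C) :
    Continuous fun P : Ω → ℝ => condMutualInfo P f g h :=
  ((continuous_entropy _).sub (continuous_entropy _)).sub
    ((continuous_entropy _).sub (continuous_entropy _))

lemma continuous_inputOutput {D E : Type*} (q : D → E → ℝ) : Continuous fun p : D → ℝ => inputOutput p q :=
  continuous_pi fun ω => (continuous_apply ω.1).mul continuous_const

lemma mutualInfo_nonneg {P : Ω → ℝ} (hP : P ∈ stdSimplex ℝ Ω) (f : Ω → A) (g : Ω → B) :
    0 ≤ mutualInfo P f g :=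
  sub_nonneg.2 (condEntropy_le_entropy hP f g)

lemma condMutualInfo_nonneg {P : Ω → ℝ} (hP : P ∈ stdSimplex ℝ Ω) (f : Ω → A) (g : Ω → B)
    (h : Ω → C) : 0 ≤ condMutualInfo P f g h :=
  sub_nonneg.2 (condEntropy_le_of_comp hP.1 f (fun ω => (g ω, h ω)) Prod.snd)

end Continuity

/-- Closed conditions with slack `ε`, satisfied in a compact set for every `ε > 0`, are satisfied
there without slack. -/
lemma exists_limit_of_isCompact {E : Type*} [TopologicalSpace E] [FirstCountableTopology E]
    {K : Set E} (hK : IsCompact K) (x : ℝ → E) (hx : ∀ ε, 0 < ε → x ε ∈ K) :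
    ∃ t ∈ K, ∀ F : ℝ × E → ℝ, Continuous F → (∀ ε, 0 < ε → 0 ≤ F (ε, x ε)) → 0 ≤ F (0, t) := by
  have hpos : ∀ m : ℕ, (0 : ℝ) < 1 / (m + 1) := fun m => by positivity
  -- The limit point is fixed before any `F` is considered, so a single `t` serves every constraint.
  obtain ⟨t, ht, φ, hφ, hlim⟩ := hK.tendsto_subseq fun m => hx _ (hpos m)
  refine ⟨t, ht, fun F hF h => ?_⟩
  have h0 : Filter.Tendsto (fun m => (1 : ℝ) / (φ m + 1)) Filter.atTop (nhds 0) :=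
    tendsto_one_div_add_atTop_nhds_zero_nat.comp hφ.tendsto_atTop
  exact ge_of_tendsto' ((hF.tendsto (0, t)).comp (h0.prodMk_nhds hlim)) fun m => h _ (hpos _)

/-! ### Rate-distortion functions in terms of joint laws -/

section RateDistortion

variable {T A B : Type*} [Fintype T] [Fintype A] [Fintype B]

/-- Disintegrating the law of (α, β) gives a test channel with the same distortions and the same
information, so every joint law bounds the rate-distortion infimum from above. -/
lemma exists_testChannel {π : T → ℝ} (hπ : π ∈ stdSimplex ℝ T) (α : T → A) (β : T → B) :
    ∃ q : A → B → ℝ, IsStochastic q ∧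
      (∀ φ : A → B → ℝ, ∑ a, ∑ b, pmfOf π α a * q a b * φ a b = ∑ t, π t * φ (α t) (β t)) ∧
      mutualInfo (inputOutput (pmfOf π α) q) Prod.fst Prod.snd = mutualInfo π α β := by
  obtain ⟨q, hq, h⟩ := exists_kernel (pmfOf_mem_stdSimplex π hπ fun t => (α t, β t))
  have hα : pmfOf (pmfOf π fun t => (α t, β t)) Prod.fst = pmfOf π α :=
    funext fun a => pmfOf_pmfOf π (fun t => (α t, β t)) Prod.fst a
  rw [hα] at h
  refine ⟨q, hq, fun φ => ?_, ?_⟩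
  · rw [← sum_pmfOf_mul π (fun t => (α t, β t)) (fun ab => φ ab.1 ab.2), h, Fintype.sum_prod_type]
    rfl
  · rw [← h]
    unfold mutualInfo condEntropy
    simp only [entropy_pmfOf]

lemma classicRDF_le {π : T → ℝ} (hπ : π ∈ stdSimplex ℝ T) (α : T → A) (β : T → B)
    {d : A → B → ℝ} {D : ℝ} (h : ∑ t, π t * d (α t) (β t) ≤ D) :
    classicRDF (pmfOf π α) d D ≤ (mutualInfo π α β : ℝ) := by
  obtain ⟨q, hq, h1, h2⟩ := exists_testChannel hπ α β
  rw [← h2]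
  exact iInf_le_of_le q (iInf_le_of_le hq (iInf_le_of_le ((h1 d).trans_le h) le_rfl))

lemma semanticRDF_le {S U Sh Uh : Type*} [Fintype S] [Fintype U] [Fintype Sh] [Fintype Uh]
    {c : EncoderCase} {p : S × U → ℝ} {dS : S → Sh → ℝ} {dU : U → Uh → ℝ} {Ds Du : ℝ}
    {π : (S × U) × (Sh × Uh) → ℝ} (hπ : π ∈ stdSimplex ℝ _) (hp : pmfOf π Prod.fst = p)
    (hS : ∑ t, π t * dS t.1.1 t.2.1 ≤ Ds) (hU : ∑ t, π t * dU t.1.2 t.2.2 ≤ Du)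
    (hm : c = EncoderCase.observationOnly → ∑ t, π t * modifiedDist p dS t.1.2 t.2.1 ≤ Ds) :
    semanticRDF c p dS dU Ds Du ≤ (semInfo c π : ℝ) := by
  cases c with
  | observationOnly =>
    obtain ⟨q, hq, h1, h2⟩ := exists_testChannel hπ (fun t => t.1.2) (fun t => t.2)
    have hpU : pmfOf π (fun t => t.1.2) = pmfOf p Prod.snd := by
      rw [← hp]
      exact (funext fun u => pmfOf_pmfOf π Prod.fst Prod.snd u).symm
    rw [hpU] at h1 h2
    unfold semInfo semanticRDF
    dsimp only
    rw [← h2]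
    exact iInf_le_of_le q (iInf_le_of_le hq (iInf_le_of_le
      ((h1 fun u b => modifiedDist p dS u b.1).trans_le (hm rfl))
      (iInf_le_of_le ((h1 fun u b => dU u b.2).trans_le hU) le_rfl)))
  | semanticAndObservation =>
    obtain ⟨q, hq, h1, h2⟩ := exists_testChannel hπ (fun t => t.1) (fun t => t.2)
    rw [show pmfOf π (fun t => t.1) = p from hp] at h1 h2
    unfold semInfo semanticRDF
    dsimp only
    rw [← h2]
    exact iInf_le_of_le q (iInf_le_of_le hq (iInf_le_of_le
      ((h1 fun a b => dS a.1 b.1).trans_le hS)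
      (iInf_le_of_le ((h1 fun a b => dU a.2 b.2).trans_le hU) le_rfl)))

lemma continuous_semInfo {S U Sh Uh : Type*} [Fintype S] [Fintype U] [Fintype Sh] [Fintype Uh]
    (c : EncoderCase) : Continuous (semInfo (S := S) (U := U) (Sh := Sh) (Uh := Uh) c) := by
  cases c
  · exact continuous_mutualInfo _ _
  · exact continuous_mutualInfo _ _

/-- Since `R` is subtracted, an upper bound on it by a real number suffices. -/
lemma coe_le_of_le_of_le_add {Δ a b h : ℝ} {R : EReal} (hR : R ≤ (b : ℝ))
    (hΔ : 0 ≤ a + h - b - Δ) : (Δ : EReal) ≤ (a : ℝ) - R + (h : ℝ) :=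
  calc (Δ : EReal) ≤ ((a - b + h : ℝ) : EReal) := by
        exact_mod_cast (by linarith : Δ ≤ a - b + h)
    _ = ((a : ℝ) : EReal) - (b : ℝ) + (h : ℝ) := by push_cast; rfl
    _ ≤ (a : ℝ) - R + (h : ℝ) := by
        gcongr
        exact EReal.sub_le_sub le_rfl hR

end RateDistortion

/-! ### From codes with slack to limiting single-letter laws. -/

section Achievable

variable {S U Sh Uh X Y Z : Type*} [Fintype S] [Fintype U] [Fintype Sh] [Fintype Uh]
  [Fintype X] [Fintype Y] [Fintype Z] [Nonempty X]

/-- The single-letter constraints, with slack `ε`, satisfied by the averaged laws of the channel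
input (first component) and of the source letters with their reconstructions (second). -/
def SingleLetter (c : EncoderCase) (p : S × U → ℝ) (dS : S → Sh → ℝ) (dU : U → Uh → ℝ)
    (V : X → Y → ℝ) (Q : X → Y × Z → ℝ) (r Rk Ds Du Δs Δu Δsu ε : ℝ)
    (t : (X → ℝ) × ((S × U) × (Sh × Uh) → ℝ)) : Prop :=
  pmfOf t.2 Prod.fst = p ∧
  0 ≤ Ds + ε - ∑ a, t.2 a * dS a.1.1 a.2.1 ∧
  0 ≤ Du + ε - ∑ a, t.2 a * dU a.1.2 a.2.2 ∧
  (c = EncoderCase.observationOnly →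
    0 ≤ Ds + ε - ∑ a, t.2 a * modifiedDist p dS a.1.2 a.2.1) ∧
  0 ≤ (r + ε) * mutualInfo (inputOutput t.1 V) Prod.fst Prod.snd - semInfo c t.2 ∧
  0 ≤ Rk + ε + (r + ε) *
      condMutualInfo (inputOutput t.1 Q) Prod.fst (fun a => a.2.1) (fun a => a.2.2)
    + entropy p Prod.fst - mutualInfo t.2 (fun a => a.1.1) (fun a => a.2.1) - (Δs - ε) ∧
  0 ≤ Rk + ε + (r + ε) *
      condMutualInfo (inputOutput t.1 Q) Prod.fst (fun a => a.2.1) (fun a => a.2.2)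
    + entropy p Prod.snd - mutualInfo t.2 (fun a => a.1.2) (fun a => a.2.2) - (Δu - ε) ∧
  0 ≤ Rk + ε + (r + ε) *
      condMutualInfo (inputOutput t.1 Q) Prod.fst (fun a => a.2.1) (fun a => a.2.2)
    + entropy p id - semInfo c t.2 - (Δsu - ε)

variable {p : S × U → ℝ} {dS : S → Sh → ℝ} {dU : U → Uh → ℝ} {V : X → Y → ℝ}
  {Q : X → Y × Z → ℝ} {c : EncoderCase} {r Rk Ds Du Δs Δu Δsu : ℝ}

lemma Achievable.exists_singleLetter (hp : p ∈ stdSimplex ℝ (S × U)) (hV : IsStochastic V)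
    (hQ : IsStochastic Q) (hQV : ∀ x y, pmfOf (Q x) Prod.fst y = V x y)
    (h : Achievable c p dS dU Q r Rk Ds Du Δs Δu Δsu) {ε : ℝ} (hε : 0 < ε) :
    ∃ t ∈ stdSimplex ℝ X ×ˢ stdSimplex ℝ ((S × U) × (Sh × Uh)),
      SingleLetter c p dS dU V Q r Rk Ds Du Δs Δu Δsu ε t := by
  obtain ⟨k, n, hk, C, hn, hK, hdS, hdU, hs, hu, hsu⟩ := h.2 ε hε
  have hP := C.law_mem hp hQ
  obtain ⟨pX, hpX, hX⟩ := exists_isAverage hP (fun ω => ω.2.2.2.1) (Or.inr ‹Nonempty X›)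
  obtain ⟨π, hπ, hA⟩ := exists_isAverage hP C.letters (Or.inl hk)
  have hk' : (0 : ℝ) < k := by exact_mod_cast hk
  rw [div_le_iff₀ hk'] at hn
  rw [one_div, inv_mul_le_iff₀ hk'] at hK
  have eS : ∑ a, π a * dS a.1.1 a.2.1 = C.distS p Q dS :=
    C.expect_letters hk hA fun a => dS a.1.1 a.2.1
  have eU : ∑ a, π a * dU a.1.2 a.2.2 = C.distU p Q dU :=
    C.expect_letters hk hA fun a => dU a.1.2 a.2.2
  have hI := mutualInfo_nonneg (inputOutput_mem_stdSimplex hpX hV) Prod.fst Prod.snd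
  have hC := condMutualInfo_nonneg (inputOutput_mem_stdSimplex hpX hQ) Prod.fst
    (fun a => a.2.1) (fun a => a.2.2)
  -- Dividing by `k` and replacing n/k by r + ε is legitimate because the information it multiplies
  -- is nonnegative.
  have key : ∀ {e H : ℝ}, k * e ≤ k * H + Real.logb 2 C.keySize + n *
      condMutualInfo (inputOutput pX Q) Prod.fst (fun a => a.2.1) (fun a => a.2.2) →
      e ≤ H + (Rk + ε) + (r + ε) *
        condMutualInfo (inputOutput pX Q) Prod.fst (fun a => a.2.1) (fun a => a.2.2) := by
    intro e H he
    have := mul_le_mul_of_nonneg_right hn hC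
    refine le_of_mul_le_mul_left ?_ hk'
    linarith
  have hS := key (C.equivS_le hk hp hQ hA hπ hpX hX)
  have hU := key (C.equivU_le hk hp hQ hA hπ hpX hX)
  have hSU := key (C.equivSU_le hk hp hQ hA hπ hpX hX)
  refine ⟨(pX, π), ⟨hpX, hπ⟩, C.source_marginal hk hp hQ hA, ?_, ?_, fun hc => ?_, ?_, ?_, ?_, ?_⟩
  · rw [eS]; linarith
  · rw [eU]; linarith
  · rw [C.expect_modifiedDist hk hp hQ hA hc, eS]; linarith
  · have h1 := C.semInfo_le hk hV hQV hp hQ hA hπ hpX hX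
    have h2 := mul_le_mul_of_nonneg_right hn hI
    rw [sub_nonneg]
    refine le_of_mul_le_mul_left ?_ hk'
    linarith
  all_goals dsimp only; linarith

lemma Achievable.exists_singleLetter_zero (hp : p ∈ stdSimplex ℝ (S × U)) (hV : IsStochastic V)
    (hQ : IsStochastic Q) (hQV : ∀ x y, pmfOf (Q x) Prod.fst y = V x y)
    (h : Achievable c p dS dU Q r Rk Ds Du Δs Δu Δsu) :
    ∃ t ∈ stdSimplex ℝ X ×ˢ stdSimplex ℝ ((S × U) × (Sh × Uh)),
      SingleLetter c p dS dU V Q r Rk Ds Du Δs Δu Δsu 0 t := by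
  choose! x hx hx' using fun (ε : ℝ) (hε : 0 < ε) => h.exists_singleLetter hp hV hQ hQV hε
  obtain ⟨t, ht, hF⟩ := exists_limit_of_isCompact
    ((isCompact_stdSimplex ℝ X).prod (isCompact_stdSimplex ℝ ((S × U) × (Sh × Uh)))) x hx
  have c0 : Continuous fun y : ℝ × (X → ℝ) × ((S × U) × (Sh × Uh) → ℝ) => y.2.2 := by fun_prop
  have c1 := continuous_condMutualInfo (Ω := X × Y × Z) Prod.fst (fun a => a.2.1) (fun a => a.2.2)
    |>.comp (continuous_inputOutput Q) |>.comp
    (continuous_fst.comp continuous_snd : Continuous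
      fun y : ℝ × (X → ℝ) × ((S × U) × (Sh × Uh) → ℝ) => y.2.1)
  have c2 := continuous_mutualInfo (Ω := X × Y) Prod.fst Prod.snd
    |>.comp (continuous_inputOutput V) |>.comp
    (continuous_fst.comp continuous_snd : Continuous
      fun y : ℝ × (X → ℝ) × ((S × U) × (Sh × Uh) → ℝ) => y.2.1)
  have c3 := (continuous_semInfo c).comp c0
  have c4 := (continuous_mutualInfo (fun a => a.1.1) (fun a => a.2.1)).comp c0
  have c5 := (continuous_mutualInfo (fun a => a.1.2) (fun a => a.2.2)).comp c0
  have cE : ∀ φ : (S × U) × (Sh × Uh) → ℝ,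
      Continuous fun y : ℝ × (X → ℝ) × ((S × U) × (Sh × Uh) → ℝ) => ∑ a, y.2.2 a * φ a :=
    fun φ => by fun_prop
  have cr : ∀ a : ℝ, Continuous
      fun y : ℝ × (X → ℝ) × ((S × U) × (Sh × Uh) → ℝ) => a + y.1 := fun a => by fun_prop
  have cs : ∀ a : ℝ, Continuous
      fun y : ℝ × (X → ℝ) × ((S × U) × (Sh × Uh) → ℝ) => a - y.1 := fun a => by fun_prop
  refine ⟨t, ht, funext fun a => ?_, ?_, ?_, fun hc => ?_, ?_, ?_, ?_, ?_⟩
  · have cm := (continuous_pmfOf Prod.fst a).comp c0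
    -- The marginal condition is an equality, so it passes to the limit as two inequalities.
    have h1 := hF _ (cm.sub (continuous_const (y := p a))) fun ε hε => by
      simp [(hx' ε hε).1]
    have h2 := hF _ ((continuous_const (y := p a)).sub cm) fun ε hε => by
      simp [(hx' ε hε).1]
    exact le_antisymm (sub_nonneg.1 h2) (sub_nonneg.1 h1)
  · exact hF _ ((cr Ds).sub (cE _)) fun ε hε => (hx' ε hε).2.1
  · exact hF _ ((cr Du).sub (cE _)) fun ε hε => (hx' ε hε).2.2.1
  · exact hF _ ((cr Ds).sub (cE _)) fun ε hε => (hx' ε hε).2.2.2.1 hc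
  · exact hF _ (((cr r).mul c2).sub c3) fun ε hε => (hx' ε hε).2.2.2.2.1
  · exact hF _ (((((cr Rk).add ((cr r).mul c1)).add continuous_const).sub c4).sub (cs Δs))
      fun ε hε => (hx' ε hε).2.2.2.2.2.1
  · exact hF _ (((((cr Rk).add ((cr r).mul c1)).add continuous_const).sub c5).sub (cs Δu))
      fun ε hε => (hx' ε hε).2.2.2.2.2.2.1
  · exact hF _ (((((cr Rk).add ((cr r).mul c1)).add continuous_const).sub c3).sub (cs Δsu))
      fun ε hε => (hx' ε hε).2.2.2.2.2.2.2

end Achievable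

end SemanticWiretap

theorem theorem1 {S U Sh Uh X Y Z : Type*} [Fintype S] [Fintype U] [Fintype Sh] [Fintype Uh]
    [Fintype X] [Fintype Y] [Fintype Z] [Nonempty X]
    (p : S × U → ℝ) (hp : p ∈ stdSimplex ℝ (S × U))
    (dS : S → Sh → ℝ) (hdS : ∀ s sh, 0 ≤ dS s sh)
    (dU : U → Uh → ℝ) (hdU : ∀ u uh, 0 ≤ dU u uh)
    (V : X → Y → ℝ) (hV : IsStochastic V) (V' : Y → Z → ℝ) (hV' : IsStochastic V')
    (Q : X → Y × Z → ℝ) (hQ : ∀ x y z, Q x (y, z) = V x y * V' y z)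
    (c : EncoderCase) (r Rk Ds Du Δs Δu Δsu : ℝ)
    (h : Achievable c p dS dU Q r Rk Ds Du Δs Δu Δsu) :
    ∃ pX ∈ stdSimplex ℝ X, ∃ Cs Cu Csu : ℝ,
      IsGreatest (secrecyValues c pX Q Prod.fst) Cs ∧
      IsGreatest (secrecyValues c pX Q Prod.snd) Cu ∧
      IsGreatest (secrecyValues c pX Q id) Csu ∧
      semanticRDF c p dS dU Ds Du ≤
        ((r * mutualInfo (inputOutput pX V) Prod.fst Prod.snd : ℝ) : EReal) ∧
      (Δs : EReal) ≤ ((Rk + r * Cs : ℝ) : EReal)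
        - classicRDF (pmfOf p Prod.fst) dS Ds + (entropy p Prod.fst : ℝ) ∧
      (Δu : EReal) ≤ ((Rk + r * Cu : ℝ) : EReal)
        - classicRDF (pmfOf p Prod.snd) dU Du + (entropy p Prod.snd : ℝ) ∧
      (Δsu : EReal) ≤ ((Rk + r * Csu : ℝ) : EReal)
        - semanticRDF c p dS dU Ds Du + (entropy p id : ℝ) := by
  -- Degradedness presents each `Q x` as the joint law of input and output of `V'` fed with `V x`.
  -- So `Q` is stochastic with Y-marginal `V`.
  have hQio : ∀ x, Q x = inputOutput (V x) V' := fun x => funext fun yz => hQ x yz.1 yz.2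
  have hQs : IsStochastic Q := fun x => by
    rw [hQio]
    exact inputOutput_mem_stdSimplex (hV x) hV'
  have hQV : ∀ x y, pmfOf (Q x) Prod.fst y = V x y := fun x y => by
    rw [hQio]
    exact (hasKernel_inputOutput (V x) hV').1 y
  obtain ⟨⟨pX, π⟩, ⟨hpX, hπ⟩, hm, hDs, hDu, hDm, hI, hs, hu, hsu⟩ :=
    h.exists_singleLetter_zero hp hV hQs hQV
  simp only [add_zero, sub_zero, sub_nonneg] at hpX hπ hm hDs hDu hDm hI hs hu hsu
  have hsem := semanticRDF_le hπ hm hDs hDu hDm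
  have hRs := classicRDF_le hπ (fun a => a.1.1) (fun a => a.2.1) hDs
  have hRu := classicRDF_le hπ (fun a => a.1.2) (fun a => a.2.2) hDu
  rw [show pmfOf π (fun a => a.1.1) = pmfOf p Prod.fst by
    rw [← hm]; exact (funext fun a => pmfOf_pmfOf π Prod.fst Prod.fst a).symm] at hRs
  rw [show pmfOf π (fun a => a.1.2) = pmfOf p Prod.snd by
    rw [← hm]; exact (funext fun a => pmfOf_pmfOf π Prod.fst Prod.snd a).symm] at hRu
  -- All three maxima are filled by the same number, I(X;Y|Z) under `pX`.
  refine ⟨pX, hpX, _, _, _,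
    isGreatest_secrecyValues c hpX hQs Prod.fst fun a b e => e,
    isGreatest_secrecyValues c hpX hQs Prod.snd fun a b e => e,
    isGreatest_secrecyValues c hpX hQs id fun a b e => congrArg Prod.fst e,
    hsem.trans (EReal.coe_le_coe_iff.2 hI), ?_, ?_, ?_⟩
  · exact coe_le_of_le_of_le_add hRs (by linarith)
  · exact coe_le_of_le_of_le_add hRu (by linarith)
  · exact coe_le_of_le_of_le_add hsem (by linarith)
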